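/- **Theorem 5.1 (transference of domination).** Let $(\widetilde X,\tilde\nu)$ and $(X,\nu)$ be $\sigma$-finite measure spaces and let $\widetilde H = L_2(\widetilde X,\tilde\nu)$ and $H = L_2(X,\nu)$ be the complex $L_2$-spaces. Let $U$ and $V$ be complex Hilbert spaces that are continuously and densely embedded into $\widetilde H$, and let $j_1\colon U\to H$ and $j_2\colon V\to H$ be bounded linear maps with dense range. Let $\mathfrak a\colon U\times U\to\mathbb C$ and $\mathfrak b\colon V\times V\to\mathbb C$ be sesquilinear forms (linear in the first variable) such that, with constants $M\ge 0$, $\mu>0$ and $\omega\in\mathbb R$, for all $u,v\in U$: * (continuity) $|\mathfrak a(u,v)|\le M\|u\|_U\|v\|_U$; * (accretivity) $\operatorname{Re}\mathfrak a(u,u)\ge 0$; * (quasi-coercivity) $\operatorname{Re}\mathfrak a(u,u)+\omega\|u\|_{\widetilde H}^2\ge\mu\|u\|_U^2$; * ($j_1$-ellipticity) $\operatorname{Re}\mathfrak a(u,u)+\omega\|j_1(u)\|_H^2\ge\mu\|u\|_U^2$ (where $\omega,\mu$ may differ from those in the previous line); and similarly for $\mathfrak b$, with $V$ and $j_2$ in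 place of $U$ and $j_1$. The operator $A$ associated with $(\mathfrak a,j_1)$ is the operator in $H$ for which $\varphi\in D(A)$ and $A\varphi=\psi$ if and only if there is a $u\in U$ with $j_1(u)=\varphi$ and $\mathfrak a(u,v)=(\psi,j_1(v))_H$ for all $v\in U$; the operator $B$ associated with $(\mathfrak b,j_2)$ is defined similarly. Let $\widetilde A$ and $\widetilde B$ be the operators in $\widetilde H$ associated in the same way with $\mathfrak a$ and $\mathfrak b$ and the embeddings of $U$ and $V$ into $\widetilde H$. Let $\widetilde S,\widetilde T$ be the strongly continuous semigroups on $\widetilde H$ generated by $-\widetilde A,-\widetilde B$. Write $\operatorname{sgn} z=z/|z|$ for $z\in\mathbb C\setminus\{0\}$ and $\operatorname{sgn}0=0$; the operations $\operatorname{Re}$, $\vee$, $|\cdot|$, $\operatorname{sgn}$ and the relation $\le$ on functions are pointwise almost everywhere. Suppose that 1. $\widetilde S$ is dominated by $\widetilde T$, that is, $|\widetilde S(t)f|\le\widetilde T(t)|f|$ for all $t\ge0$ and $f\in\widetilde H$; 2. the maps $j_1$ and $j_2$ satisfy * $j_2(\operatorname{Re}v)=\operatorname{Re}j_2(v)$ for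 all $v\in V$, * $j_2(v_1\vee v_2)=j_2(v_1)\vee j_2(v_2)$ for all real-valued $v_1,v_2\in V$, * $j_2(|u|)=|j_1(u)|$ for all $u\in U$, * $j_1(|v|\operatorname{sgn}u)=|j_2(v)|\operatorname{sgn}(j_1(u))$ for all $(u,v)\in U\times V$ with $|v|\le|u|$. (Condition 1 implies that $\operatorname{Re}v,\ v_1\vee v_2,\ |u|\in V$ and $|v|\operatorname{sgn}u\in U$ in the situations of condition 2, so that these expressions make sense.) Then $-A$ and $-B$ generate unique strongly continuous semigroups $S=(S(t))_{t\ge0}$ and $T=(T(t))_{t\ge0}$ on $H$, and $S$ is dominated by $T$, that is, $$|S(t)\varphi|\le T(t)|\varphi|\qquad\text{for all } t\ge0 \text{ and } \varphi\in H .$$ -/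

import Mathlib

open MeasureTheory Filter Topology
open scoped NNReal

noncomputable section

namespace FormDomination

/-! ### Sesquilinear forms on a Hilbert space and their associated operators -/

section Forms

variable {V H : Type*} [NormedAddCommGroup V] [InnerProductSpace ℂ V]
  [NormedAddCommGroup H] [InnerProductSpace ℂ H]

/-- Sesquilinear forms on `V`: linear in the first and antilinear in the second variable. -/
abbrev Form (V : Type*) [NormedAddCommGroup V] [InnerProductSpace ℂ V] : Type _ :=
  V →ₗ[ℂ] V →ₗ⋆[ℂ] ℂ

/-- Continuity of a form: `|a(u,v)| ≤ M ‖u‖ ‖v‖`. -/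
def Form.IsBounded (a : Form V) : Prop :=
  ∃ M : ℝ, 0 ≤ M ∧ ∀ u v : V, ‖a u v‖ ≤ M * ‖u‖ * ‖v‖

/-- Accretivity of a form: `Re a(u,u) ≥ 0`. -/
def Form.IsAccretive (a : Form V) : Prop :=
  ∀ u : V, 0 ≤ (a u u).re

/-- `j`-ellipticity: `Re a(u,u) + ω ‖j u‖² ≥ μ ‖u‖²` for some real `ω` and some `μ > 0`. When `j`
is a continuous dense embedding of `V` into `H`, this is quasi-coercivity of the form. -/
def Form.IsElliptic (a : Form V) (j : V →L[ℂ] H) : Prop :=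
  ∃ ω μ : ℝ, 0 < μ ∧ ∀ u : V, μ * ‖u‖ ^ 2 ≤ (a u u).re + ω * ‖j u‖ ^ 2

/-- The graph of the operator `A` associated with `(a, j)`: `a.AssocOp j φ ψ` says that
`φ ∈ D(A)` and `A φ = ψ`, that is, there is `u ∈ V` with `j u = φ` and `a(u,v) = (ψ, j v)` for all
`v ∈ V`. (Mathlib's inner product is antilinear in its first variable.) When `j` is a continuous
dense embedding, this is the usual operator associated with the form `a`. -/
def Form.AssocOp (a : Form V) (j : V →L[ℂ] H) (φ ψ : H) : Prop :=
  ∃ u : V, j u = φ ∧ ∀ v : V, a u v = inner ℂ (j v) ψ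

/-- `S` is a strongly continuous semigroup of bounded operators on `H` whose generator is exactly
`-A`, where `A` is the operator with graph `{(φ, ψ) | A φ ψ}`. -/
structure IsSemigroupGeneratedByNeg (S : ℝ≥0 → H →L[ℂ] H) (A : H → H → Prop) : Prop where
  map_zero : S 0 = ContinuousLinearMap.id ℂ H
  map_add : ∀ s t : ℝ≥0, S (s + t) = (S s).comp (S t)
  continuous : ∀ x : H, Continuous fun t : ℝ≥0 => S t x
  generator : ∀ φ ψ : H, A φ ψ ↔
    Tendsto (fun t : ℝ≥0 => (t : ℝ)⁻¹ • (S t φ - φ)) (𝓝[>] 0) (𝓝 (-ψ))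

end Forms

/-! ### Lattice operations on complex `L₂` -/

section Lattice

variable {X : Type*} [MeasurableSpace X] {μ : Measure X}

/-- The modulus `|f|`. -/
def absL2 (f : Lp ℂ 2 μ) : Lp ℂ 2 μ :=
  MemLp.toLp (fun x => ((‖f x‖ : ℝ) : ℂ)) (Lp.memLp f).norm.ofReal

/-- The real part `Re f`. -/
def reL2 (f : Lp ℂ 2 μ) : Lp ℂ 2 μ :=
  MemLp.toLp (fun x => (((f x).re : ℝ) : ℂ)) (Lp.memLp f).re.ofReal

/-- `f` is real-valued (almost everywhere). -/
def IsRealL2 (f : Lp ℂ 2 μ) : Prop :=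
  ∀ᵐ x ∂μ, (f x).im = 0

/-- The supremum `f ∨ g`, meant for real-valued `f` and `g`. -/
def supL2 (f g : Lp ℂ 2 μ) : Lp ℂ 2 μ :=
  MemLp.toLp (fun x => ((max (f x).re (g x).re : ℝ) : ℂ))
    ((Lp.memLp f).re.sup (Lp.memLp g).re).ofReal

/-- The complex sign: `z / |z|` for `z ≠ 0` and `0` for `z = 0`. -/
def csign (z : ℂ) : ℂ := if z = 0 then 0 else z / (‖z‖ : ℂ)

theorem norm_csign_le (z : ℂ) : ‖csign z‖ ≤ 1 := by
  unfold csign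
  split_ifs with h
  · simp
  · simp [h]

theorem measurable_csign : Measurable csign := by
  unfold csign
  exact Measurable.ite (measurableSet_singleton 0) measurable_const (by fun_prop)

theorem memLp_abs_mul_sign (f g : Lp ℂ 2 μ) :
    MemLp (fun x => ((‖f x‖ : ℝ) : ℂ) * csign (g x)) 2 μ := by
  refine MemLp.of_le (Lp.memLp f) ?_ (Eventually.of_forall fun x => ?_)
  · have hf : AEMeasurable (fun x => ((‖f x‖ : ℝ) : ℂ)) μ :=
      (Lp.memLp f).norm.ofReal.aestronglyMeasurable.aemeasurable
    have hg : AEMeasurable (fun x => csign (g x)) μ :=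
      measurable_csign.comp_aemeasurable (Lp.aestronglyMeasurable g).aemeasurable
    exact (hf.mul hg).aestronglyMeasurable
  · rw [norm_mul]
    calc _ ≤ ‖((‖f x‖ : ℝ) : ℂ)‖ * 1 :=
          mul_le_mul_of_nonneg_left (norm_csign_le _) (norm_nonneg _)
      _ = ‖f x‖ := by simp

/-- The product `|f| sgn g`. -/
def absMulSignL2 (f g : Lp ℂ 2 μ) : Lp ℂ 2 μ :=
  MemLp.toLp _ (memLp_abs_mul_sign f g)

/-- `|f| ≤ |g|` almost everywhere. -/
def AbsLeAbs (f g : Lp ℂ 2 μ) : Prop :=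
  ∀ᵐ x ∂μ, ‖f x‖ ≤ ‖g x‖

/-- `|f| ≤ g` almost everywhere; in particular `g` is real-valued. -/
def AbsLe (f g : Lp ℂ 2 μ) : Prop :=
  ∀ᵐ x ∂μ, (g x).im = 0 ∧ ‖f x‖ ≤ (g x).re

/-- `S` is dominated by `T`: `|S(t) f| ≤ T(t) |f|` for all `t ≥ 0` and all `f`. -/
def IsDominatedBy (S T : ℝ≥0 → Lp ℂ 2 μ →L[ℂ] Lp ℂ 2 μ) : Prop :=
  ∀ (t : ℝ≥0) (f : Lp ℂ 2 μ), AbsLe (S t f) (T t (absL2 f))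

end Lattice

/-! ### Compatibility of `j₁` and `j₂` with the lattice operations -/

section Compatibility

variable {X' X : Type*} [MeasurableSpace X'] [MeasurableSpace X] {μ' : Measure X'} {μ : Measure X}
  {U V : Type*} [NormedAddCommGroup U] [InnerProductSpace ℂ U]
  [NormedAddCommGroup V] [InnerProductSpace ℂ V]

/-- The four compatibility properties of `j₁ : U → L₂(X)` and `j₂ : V → L₂(X)`, where `U` and `V`
are embedded into `L₂(X')` through `ι₁` and `ι₂`. A phrase such as `ι₂ w = reL2 (ι₂ v)` says that
the element `w` of `V` is `Re v`. -/
structure LatticeCompatible (ι₁ : U →L[ℂ] Lp ℂ 2 μ') (ι₂ : V →L[ℂ] Lp ℂ 2 μ')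
    (j₁ : U →L[ℂ] Lp ℂ 2 μ) (j₂ : V →L[ℂ] Lp ℂ 2 μ) : Prop where
  /-- `j₂ (Re v) = Re (j₂ v)`. -/
  map_re : ∀ v w : V, ι₂ w = reL2 (ι₂ v) → j₂ w = reL2 (j₂ v)
  /-- `j₂ (v₁ ∨ v₂) = j₂ v₁ ∨ j₂ v₂` for real-valued `v₁`, `v₂`. -/
  map_sup : ∀ v₁ v₂ w : V, IsRealL2 (ι₂ v₁) → IsRealL2 (ι₂ v₂) →
    ι₂ w = supL2 (ι₂ v₁) (ι₂ v₂) → j₂ w = supL2 (j₂ v₁) (j₂ v₂)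
  /-- `j₂ |u| = |j₁ u|`. -/
  map_abs : ∀ (u : U) (w : V), ι₂ w = absL2 (ι₁ u) → j₂ w = absL2 (j₁ u)
  /-- `j₁ (|v| sgn u) = |j₂ v| sgn (j₁ u)` whenever `|v| ≤ |u|`. -/
  map_abs_mul_sign : ∀ (u : U) (v : V) (w : U), AbsLeAbs (ι₂ v) (ι₁ u) →
    ι₁ w = absMulSignL2 (ι₂ v) (ι₁ u) → j₁ w = absMulSignL2 (j₂ v) (j₁ u)

end Compatibility

end FormDomination

end

noncomputable section

namespace FormDomination

/-! ### Powers and strong limits of contractions. -/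

section Operators

variable {H : Type*} [NormedAddCommGroup H] [InnerProductSpace ℂ H]

/-! Domination of one semigroup by another means that their direct sum leaves the closed convex cone
`C = {(f, g) : |f| ≤ g}` invariant. For semigroups coming from accretive forms this is equivalent to
a condition of Ouhabaz type on the forms: for all `u`, `v` the orthogonal projection onto `C` of the
image of `(u, v)` is the image of some `(w₁, w₂)` in `U × V` with `Re a(w₁, u - w₁) + Re b(w₂, v -
w₂) ≥ 0`.

The inequality does not see into which `L₂` space the form domains are mapped. It therefore passes
from the embeddings `ι₁`, `ι₂` to `j₁`, `j₂` once the same `(w₁, w₂)` is known to lie over both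
projections. This holds because the projection of `(f, g)` is given by lattice operations, namely
`(h sgn f, k)` with `h = (|f| + |f| ∧ Re g)⁺ / 2` and `k = (|f| ∨ Re g + Re g)⁺ / 2`
(`isProj_dominationCone`), which the compatibility conditions transport
(`LatticeCompatible.map_proj`).

Both halves of the criterion go through resolvents. Invariance under the semigroups gives invariance
under the resolvents (`resolvent_invariant`), and then weak limits of resolvents in the form domains
give the projection and the inequality (`exists_proj_of_resolvent_invariant`). Conversely, the
inequality makes `C` invariant under the resolvents (`resolvent_invariant_of_proj`), hence under the
semigroups by the exponential formula (`semigroup_invariant`). Existence and uniqueness of the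
semigroups are Hille–Yosida theory for m-accretive operators. -/

theorem norm_pow_apply_sub_pow_apply_le {P Q : H →L[ℂ] H} (hPQ : Commute P Q) {M : ℝ} (x : H)
    (hQ : ∀ y, ‖Q y‖ ≤ ‖y‖) (k : ℕ) (hP : ∀ i < k, ∀ y, ‖(P ^ i) y‖ ≤ M * ‖y‖) :
    ‖(P ^ k) x - (Q ^ k) x‖ ≤ k * (M * ‖P x - Q x‖) := by
  induction k with
  | zero => simp
  | succ k ih =>
    -- Telescoping: commutativity lets every summand act on the single vector `P x - Q x`.
    have h₁ : (P ^ (k + 1)) x - (Q ^ (k + 1)) x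
        = (P ^ k) (P x - Q x) + Q ((P ^ k) x - (Q ^ k) x) := by
      have h₂ : (P ^ k) (Q x) = Q ((P ^ k) x) :=
        congrArg (fun R : H →L[ℂ] H => R x) (hPQ.pow_left k).eq
      have h₃ : (Q ^ (k + 1)) x = Q ((Q ^ k) x) := by rw [pow_succ']; rfl
      have h₄ : (P ^ (k + 1)) x = (P ^ k) (P x) := by rw [pow_succ]; rfl
      rw [h₃, h₄, map_sub, map_sub, h₂]; abel
    rw [h₁]
    calc _ ≤ ‖(P ^ k) (P x - Q x)‖ + ‖Q ((P ^ k) x - (Q ^ k) x)‖ := norm_add_le _ _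
      _ ≤ M * ‖P x - Q x‖ + k * (M * ‖P x - Q x‖) :=
        add_le_add (hP k k.lt_succ_self _)
          ((hQ _).trans (ih fun i hi => hP i (hi.trans k.lt_succ_self)))
      _ = _ := by push_cast; ring

theorem norm_pow_apply_le {Q : H →L[ℂ] H} (hQ : ∀ y, ‖Q y‖ ≤ ‖y‖) (k : ℕ) (y : H) :
    ‖(Q ^ k) y‖ ≤ ‖y‖ := by
  induction k with
  | zero => simp
  | succ k ih =>
    rw [pow_succ']
    exact (hQ _).trans ih

theorem tendsto_apply_of_dense {ι : Type*} {l : Filter ι} {F : ι → H →L[ℂ] H} {G : H →L[ℂ] H}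
    (hF : ∀ᶠ i in l, ∀ y, ‖F i y‖ ≤ ‖y‖) {D : Set H} (hD : Dense D)
    (h : ∀ x ∈ D, Tendsto (fun i => F i x) l (𝓝 (G x))) (x : H) :
    Tendsto (fun i => F i x) l (𝓝 (G x)) := by
  rw [Metric.tendsto_nhds]
  intro ε hε
  have hδ : 0 < ε / (2 + ‖G‖) := by positivity
  obtain ⟨y, hyD, hy⟩ := Metric.mem_closure_iff.1 (hD x) _ hδ
  filter_upwards [hF, (Metric.tendsto_nhds.1 (h y hyD)) _ hδ] with i hi hi'
  rw [dist_eq_norm] at *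
  have h₁ : F i x - G x = F i (x - y) + (F i y - G y) + G (y - x) := by simp
  have h₂ : ‖G (y - x)‖ ≤ ‖G‖ * ‖x - y‖ := by
    rw [norm_sub_rev x y]; exact G.le_opNorm _
  have h₃ : ‖G‖ * ‖x - y‖ ≤ ‖G‖ * (ε / (2 + ‖G‖)) := by gcongr
  have h₄ : ε = ε / (2 + ‖G‖) + ε / (2 + ‖G‖) + ‖G‖ * (ε / (2 + ‖G‖)) := by
    field_simp; ring
  calc ‖F i x - G x‖ ≤ ‖F i (x - y)‖ + ‖F i y - G y‖ + ‖G (y - x)‖ := by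
        rw [h₁]; exact norm_add₃_le
    _ < ε := by linarith [hi (x - y)]

theorem norm_exp_apply_le (Q : H →L[ℂ] H) (x : H) [CompleteSpace H] :
    ‖NormedSpace.exp Q x‖ ≤ Real.exp ‖Q‖ * ‖x‖ := by
  have h₀ := NormedSpace.exp_series_hasSum_exp' (𝕂 := ℂ) Q
  have h₁ : HasSum (fun n : ℕ => ((n.factorial : ℂ)⁻¹ • Q ^ n) x) (NormedSpace.exp Q x) :=
    h₀.map (ContinuousLinearMap.apply ℂ H x) (ContinuousLinearMap.apply ℂ H x).continuous
  have h₂ : HasSum (fun n : ℕ => (n.factorial : ℝ)⁻¹ • ‖Q‖ ^ n) (Real.exp ‖Q‖) := by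
    rw [Real.exp_eq_exp_ℝ]; exact NormedSpace.exp_series_hasSum_exp' (𝕂 := ℝ) ‖Q‖
  refine h₁.norm_le_of_bounded (h₂.mul_right ‖x‖) fun n => ?_
  rw [smul_apply, norm_smul, norm_inv, smul_eq_mul, mul_assoc]
  have h₃ : ‖(Q ^ n) x‖ ≤ ‖Q‖ ^ n * ‖x‖ := by
    induction n with
    | zero => simp
    | succ n ih =>
      rw [pow_succ', pow_succ', mul_assoc]
      exact (Q.le_opNorm _).trans (mul_le_mul_of_nonneg_left ih (norm_nonneg _))
  simp only [Complex.norm_natCast]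
  gcongr

end Operators

/-! ### Comparison of commuting semigroups through their generators. -/

section Semigroups

variable {H : Type*} [NormedAddCommGroup H] [InnerProductSpace ℂ H]

/-- A one-parameter semigroup of bounded operators, without continuity. -/
structure IsOpSemigroup (S : ℝ≥0 → H →L[ℂ] H) : Prop where
  map_zero : S 0 = 1
  map_add : ∀ s t : ℝ≥0, S (s + t) = S s * S t

theorem IsOpSemigroup.map_nsmul {S : ℝ≥0 → H →L[ℂ] H} (hS : IsOpSemigroup S) (k : ℕ) (t : ℝ≥0) :
    S (k • t) = S t ^ k := by
  induction k with
  | zero => simp [hS.map_zero]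
  | succ k ih => rw [succ_nsmul, hS.map_add, ih, pow_succ]

theorem IsOpSemigroup.commute {S : ℝ≥0 → H →L[ℂ] H} (hS : IsOpSemigroup S) (s t : ℝ≥0) :
    Commute (S s) (S t) := by
  rw [commute_iff_eq, ← hS.map_add, ← hS.map_add, add_comm]

theorem IsSemigroupGeneratedByNeg.isOpSemigroup {S : ℝ≥0 → H →L[ℂ] H} {A : H → H → Prop}
    (hS : IsSemigroupGeneratedByNeg S A) : IsOpSemigroup S :=
  ⟨hS.map_zero, hS.map_add⟩

/-- `p` is the right derivative at `0` of the orbit `t ↦ F t x`, when `F 0 = 1`. -/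
def HasGenerator (F : ℝ≥0 → H →L[ℂ] H) (x p : H) : Prop :=
  Tendsto (fun t : ℝ≥0 => (t : ℝ)⁻¹ • (F t x - x)) (𝓝[>] 0) (𝓝 p)

theorem tendsto_div_succ {t : ℝ≥0} (ht : 0 < t) :
    Tendsto (fun k : ℕ => t / (k + 1 : ℝ≥0)) atTop (𝓝[>] 0) := by
  refine tendsto_nhdsWithin_iff.2 ⟨?_, Eventually.of_forall fun k => Set.mem_Ioi.2 (by positivity)⟩
  rw [← NNReal.tendsto_coe]
  simpa [div_eq_mul_inv] using
    (tendsto_one_div_add_atTop_nhds_zero_nat (𝕜 := ℝ)).const_mul (t : ℝ)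

theorem HasGenerator.norm_smul_sub_tendsto {F G : ℝ≥0 → H →L[ℂ] H} {x p q : H}
    (hF : HasGenerator F x p) (hG : HasGenerator G x q) {t : ℝ≥0} (ht : 0 < t) (M : ℝ) :
    Tendsto (fun k : ℕ => ((k + 1 : ℕ) : ℝ) *
      (M * ‖F (t / (k + 1 : ℝ≥0)) x - G (t / (k + 1 : ℝ≥0)) x‖)) atTop (𝓝 (M * t * ‖p - q‖)) := by
  have h₁ := (((hF.sub hG).comp (tendsto_div_succ ht)).norm).const_mul (M * t)
  refine h₁.congr fun k => ?_
  have h₂ : (0 : ℝ) < t := ht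
  simp only [Function.comp_apply]
  rw [← smul_sub, sub_sub_sub_cancel_right, norm_smul, Real.norm_of_nonneg (by positivity)]
  push_cast
  field_simp

/-- The telescoping estimate with `k + 1` steps of length `t / (k + 1)`, as `k → ∞`. It replaces
integration of the derivative of `s ↦ P (t - s) (Q s x)`, so only derivatives at `0` are needed. -/
theorem IsOpSemigroup.norm_sub_le {P Q : ℝ≥0 → H →L[ℂ] H} (hP : IsOpSemigroup P)
    (hQ : IsOpSemigroup Q) (hPQ : ∀ s, Commute (P s) (Q s)) {t : ℝ≥0} {M : ℝ}
    (hM : ∀ s ≤ t, ∀ y, ‖P s y‖ ≤ M * ‖y‖) (hQc : ∀ s y, ‖Q s y‖ ≤ ‖y‖) {x p q : H}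
    (hp : HasGenerator P x p) (hq : HasGenerator Q x q) :
    ‖P t x - Q t x‖ ≤ M * t * ‖p - q‖ := by
  rcases eq_or_lt_of_le (zero_le : 0 ≤ t) with rfl | ht
  · simp [hP.map_zero, hQ.map_zero]
  refine ge_of_tendsto' (hp.norm_smul_sub_tendsto hq ht M) fun k => ?_
  have hk : (k + 1) • (t / (k + 1 : ℝ≥0)) = t := by
    rw [nsmul_eq_mul]; push_cast; field_simp
  have h₁ := norm_pow_apply_sub_pow_apply_le (hPQ (t / (k + 1 : ℝ≥0))) (M := M) x
    (hQc _) (k + 1) fun i hi y => ?_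
  · rwa [← hP.map_nsmul, ← hQ.map_nsmul, hk] at h₁
  · rw [← hP.map_nsmul]
    refine hM _ ?_ y
    calc i • (t / (k + 1 : ℝ≥0)) ≤ (k + 1) • (t / (k + 1 : ℝ≥0)) := by gcongr
      _ = t := hk

end Semigroups

/-! ### m-accretive operators and their resolvents. -/

section Accretive

variable {H : Type*} [NormedAddCommGroup H] [InnerProductSpace ℂ H]

/-- The relation `A` is the graph of an m-accretive operator. -/
structure IsMAccretive (A : H → H → Prop) : Prop where
  add : ∀ {φ ψ φ' ψ'}, A φ ψ → A φ' ψ' → A (φ + φ') (ψ + ψ')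
  smul : ∀ (c : ℂ) {φ ψ}, A φ ψ → A (c • φ) (c • ψ)
  unique : ∀ {φ ψ ψ'}, A φ ψ → A φ ψ' → ψ = ψ'
  accretive : ∀ {φ ψ}, A φ ψ → 0 ≤ (inner ℂ φ ψ).re
  exists_resolvent : ∀ᶠ l : ℝ in atTop, ∀ f, ∃ φ, A φ (l • (f - φ))

/-- `J = l (l + A)⁻¹`. -/
def IsResolvent (A : H → H → Prop) (l : ℝ) (J : H →L[ℂ] H) : Prop :=
  ∀ f, A (J f) (l • (f - J f))

theorem inner_re_real_smul (l : ℝ) (x y : H) : (inner ℂ x (l • y)).re = l * (inner ℂ x y).re := by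
  rw [show l • y = (l : ℂ) • y from (Complex.coe_smul l y).symm, inner_smul_right]
  simp

namespace IsMAccretive

variable {A : H → H → Prop} (hA : IsMAccretive A)
include hA

theorem sub {φ ψ φ' ψ'} (h : A φ ψ) (h' : A φ' ψ') : A (φ - φ') (ψ - ψ') := by
  simpa [sub_eq_add_neg] using hA.add h (hA.smul (-1) h')

theorem norm_le {l : ℝ} (hl : 0 < l) {f φ : H} (h : A φ (l • (f - φ))) : ‖φ‖ ≤ ‖f‖ := by
  have h₁ := hA.accretive h
  rw [inner_re_real_smul] at h₁
  have h₂ := nonneg_of_mul_nonneg_right h₁ hl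
  rw [inner_sub_right, Complex.sub_re] at h₂
  have h₃ : (inner ℂ φ φ).re = ‖φ‖ ^ 2 := inner_self_eq_norm_sq (𝕜 := ℂ) φ
  have h₄ : (inner ℂ φ f).re ≤ ‖φ‖ * ‖f‖ := re_inner_le_norm (𝕜 := ℂ) φ f
  rcases (norm_nonneg φ).eq_or_lt with h₅ | h₅
  · rw [← h₅]; exact norm_nonneg f
  · nlinarith

theorem resolvent_unique {l : ℝ} (hl : 0 < l) {f φ φ' : H} (h : A φ (l • (f - φ)))
    (h' : A φ' (l • (f - φ'))) : φ = φ' := by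
  have h₁ := hA.sub h h'
  rw [← smul_sub, show f - φ - (f - φ') = 0 - (φ - φ') by abel] at h₁
  have h₂ := hA.norm_le hl h₁
  rw [norm_zero] at h₂
  exact sub_eq_zero.1 (norm_le_zero_iff.1 h₂)

theorem exists_isResolvent : ∃ J : ℝ → H →L[ℂ] H, ∀ᶠ l in atTop, IsResolvent A l (J l) := by
  have h : ∀ᶠ l : ℝ in atTop, ∃ J : H →L[ℂ] H, IsResolvent A l J := by
    filter_upwards [hA.exists_resolvent, eventually_gt_atTop 0] with l hl hl₀
    choose φ hφ using hl
    refine ⟨LinearMap.mkContinuous ⟨⟨φ, fun x y => ?_⟩, fun c x => ?_⟩ 1 fun x => ?_, hφ⟩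
    · refine hA.resolvent_unique hl₀ (hφ _) ?_
      convert hA.add (hφ x) (hφ y) using 1
      rw [← smul_add]; congr 1; abel
    · have h := hA.smul c (hφ x)
      rw [smul_comm c l, smul_sub c] at h
      exact hA.resolvent_unique hl₀ (hφ _) h
    · simpa using hA.norm_le hl₀ (hφ x)
  obtain ⟨l₀, hl₀⟩ := eventually_atTop.1 h
  choose J hJ using hl₀
  refine ⟨fun l => J (max l l₀) (le_max_right _ _), ?_⟩
  filter_upwards [eventually_ge_atTop l₀] with l hl
  have := hJ (max l l₀) (le_max_right _ _)
  simpa only [max_eq_left hl] using this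

variable {l : ℝ} {J : H →L[ℂ] H} (hJ : IsResolvent A l J) (hl : 0 < l)
include hJ hl

theorem norm_resolvent_le (x : H) : ‖J x‖ ≤ ‖x‖ := hA.norm_le hl (hJ x)

theorem resolvent_smul_sub {φ ψ : H} (h : A φ ψ) : l • (φ - J φ) = J ψ := by
  have h₁ : J (φ + l⁻¹ • ψ) = φ := by
    refine hA.resolvent_unique hl (hJ _) ?_
    rwa [add_sub_cancel_left, smul_smul, mul_inv_cancel₀ hl.ne', one_smul]
  rw [map_add, J.map_smul_of_tower] at h₁
  nth_rewrite 1 [← h₁]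
  rw [add_sub_cancel_left, smul_smul, mul_inv_cancel₀ hl.ne', one_smul]

theorem resolvent_commute {K : H →L[ℂ] H} (hK : ∀ φ ψ, A φ ψ → A (K φ) (K ψ)) : Commute K J := by
  rw [commute_iff_eq]
  ext f
  refine hA.resolvent_unique hl (f := K f) ?_ (hJ (K f))
  have := hK _ _ (hJ f)
  rwa [K.map_smul_of_tower, map_sub] at this

theorem resolvent_map {φ ψ : H} (h : A φ ψ) : A (J φ) (J ψ) := by
  rw [← hA.resolvent_smul_sub hJ hl h]
  exact hJ φ

end IsMAccretive

/-- For `z` orthogonal to the domain, solve `A φ = l (z - φ)`. Orthogonality reduces accretivity to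
`-l ‖φ‖² ≥ 0`, so `φ = 0`, and then `l z = A 0 = 0`. -/
theorem IsMAccretive.dense_domain [CompleteSpace H] {A : H → H → Prop} (hA : IsMAccretive A) :
    Dense {φ | ∃ ψ, A φ ψ} := by
  obtain ⟨l, hl, hl₀⟩ := (hA.exists_resolvent.and (eventually_gt_atTop 0)).exists
  obtain ⟨φ₀, hφ₀⟩ := hl 0
  let D : Submodule ℂ H :=
    { carrier := {φ | ∃ ψ, A φ ψ}
      add_mem' := fun ⟨ψ, h⟩ ⟨ψ', h'⟩ => ⟨_, hA.add h h'⟩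
      zero_mem' := ⟨_, by simpa using hA.smul 0 hφ₀⟩
      smul_mem' := fun c _ ⟨ψ, h⟩ => ⟨_, hA.smul c h⟩ }
  have hz : A 0 0 := by simpa using hA.smul 0 hφ₀
  change Dense (D : Set H)
  rw [Submodule.dense_iff_topologicalClosure_eq_top, Submodule.topologicalClosure_eq_top_iff,
    Submodule.eq_bot_iff]
  intro z hzD
  obtain ⟨φ, hφ⟩ := hl z
  have h₀ : inner ℂ φ z = 0 := (Submodule.mem_orthogonal _ _).1 hzD φ ⟨_, hφ⟩
  have h₁ := hA.accretive hφ
  rw [inner_re_real_smul, inner_sub_right, h₀, zero_sub, Complex.neg_re] at h₁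
  have h₃ : (inner ℂ φ φ).re = ‖φ‖ ^ 2 := inner_self_eq_norm_sq (𝕜 := ℂ) φ
  have h₄ : ‖φ‖ ^ 2 ≤ 0 := by
    rw [← h₃]; nlinarith
  have h₅ : φ = 0 := norm_eq_zero.1 (pow_eq_zero_iff two_ne_zero |>.1 (le_antisymm h₄ (sq_nonneg _)))
  subst h₅
  have h₆ := hA.unique hφ hz
  rw [sub_zero, smul_eq_zero] at h₆
  exact h₆.resolve_left hl₀.ne'

end Accretive

/-! ### Semigroups of the bounded Yosida approximations. -/

section Yosida

variable {H : Type*} [NormedAddCommGroup H] [InnerProductSpace ℂ H]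

/-- The semigroup generated by the Yosida approximation `l (J - 1)`. -/
def yosidaSemigroup (l : ℝ) (J : H →L[ℂ] H) (t : ℝ≥0) : H →L[ℂ] H :=
  NormedSpace.exp ((t : ℝ) • l • (J - 1))

variable [CompleteSpace H]

theorem isOpSemigroup_yosidaSemigroup (l : ℝ) (J : H →L[ℂ] H) :
    IsOpSemigroup (yosidaSemigroup l J) := by
  refine ⟨by simp [yosidaSemigroup], fun s t => ?_⟩
  let _ : NormedAlgebra ℚ (H →L[ℂ] H) := NormedAlgebra.restrictScalars ℚ ℂ _
  unfold yosidaSemigroup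
  rw [NNReal.coe_add, add_smul]
  exact NormedSpace.exp_add_of_commute (((Commute.refl _).smul_right _).smul_left _)

omit [CompleteSpace H] in
theorem commute_yosidaSemigroup_right {K J : H →L[ℂ] H} (h : Commute K J) (l : ℝ) (t : ℝ≥0) :
    Commute K (yosidaSemigroup l J t) :=
  Commute.exp_right (((h.sub_right (Commute.one_right K)).smul_right l).smul_right (t : ℝ))

/-- Factor `exp (t l (J - 1)) = e^(-t l) exp (t l J)`; the second factor has norm at most `e^(t l)`.
-/
theorem norm_yosidaSemigroup_apply_le {l : ℝ} (hl : 0 < l) {J : H →L[ℂ] H}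
    (hJ : ∀ x, ‖J x‖ ≤ ‖x‖) (t : ℝ≥0) (x : H) : ‖yosidaSemigroup l J t x‖ ≤ ‖x‖ := by
  let _ : NormedAlgebra ℚ (H →L[ℂ] H) := NormedAlgebra.restrictScalars ℚ ℂ _
  have hJ' : ‖J‖ ≤ 1 := J.opNorm_le_bound zero_le_one fun x => by simpa using hJ x
  have h₁ : (t : ℝ) • l • (J - 1) = ((-(t * l) : ℝ) : ℂ) • (1 : H →L[ℂ] H) + (t * l : ℝ) • J := by
    rw [Complex.coe_smul, smul_smul, smul_sub, neg_smul]; abel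
  have h₂ : NormedSpace.exp (((-(t * l) : ℝ) : ℂ) • (1 : H →L[ℂ] H))
      = Complex.exp ((-(t * l) : ℝ) : ℂ) • 1 := by
    rw [← Algebra.algebraMap_eq_smul_one, ← Algebra.algebraMap_eq_smul_one,
      Complex.exp_eq_exp_ℂ, NormedSpace.algebraMap_exp_comm]
  unfold yosidaSemigroup
  rw [h₁, NormedSpace.exp_add_of_commute ((Commute.one_left _).smul_left _), h₂]
  have h₃ : ‖(t * l : ℝ) • J‖ ≤ t * l := by
    rw [norm_smul, Real.norm_of_nonneg (by positivity)]
    exact mul_le_of_le_one_right (by positivity) hJ'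
  change ‖Complex.exp ((-(t * l) : ℝ) : ℂ) • (NormedSpace.exp ((t * l : ℝ) • J) x)‖ ≤ ‖x‖
  rw [norm_smul, Complex.norm_exp_ofReal]
  calc _ ≤ Real.exp (-(t * l)) * (Real.exp (t * l) * ‖x‖) := by
        gcongr
        exact (norm_exp_apply_le _ x).trans (by gcongr)
    _ = ‖x‖ := by rw [← mul_assoc, ← Real.exp_add]; simp

theorem hasGenerator_yosidaSemigroup (l : ℝ) (J : H →L[ℂ] H) (x : H) :
    HasGenerator (yosidaSemigroup l J) x (l • (J x - x)) := by
  have h₁ := hasDerivAt_exp_smul_const (𝕂 := ℝ) (l • (J - 1)) 0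
  rw [zero_smul, NormedSpace.exp_zero, one_mul, hasDerivAt_iff_tendsto_slope_zero] at h₁
  have h₂ : Tendsto (fun t : ℝ≥0 => (t : ℝ)) (𝓝[>] 0) (𝓝[≠] 0) := by
    refine tendsto_nhdsWithin_iff.2 ⟨?_, ?_⟩
    · exact (NNReal.continuous_coe.tendsto 0).mono_left nhdsWithin_le_nhds
    · filter_upwards [self_mem_nhdsWithin] with t ht
      exact (NNReal.coe_pos.2 ht).ne'
  have h₃ := (((ContinuousLinearMap.apply ℂ H x).continuous.tendsto _).comp h₁).comp h₂
  refine h₃.congr fun t => ?_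
  simp [yosidaSemigroup, NormedSpace.exp_zero]

omit [CompleteSpace H] in
theorem hasGenerator_one (x : H) : HasGenerator (fun _ => (1 : H →L[ℂ] H)) x 0 := by
  simp [HasGenerator]

omit [CompleteSpace H] in
theorem isOpSemigroup_one : IsOpSemigroup (fun _ => (1 : H →L[ℂ] H)) :=
  ⟨rfl, fun _ _ => (one_mul _).symm⟩

end Yosida

/-! ### Strong convergence of resolvents and Yosida approximations. -/

section Resolvent

variable {H : Type*} [NormedAddCommGroup H] [InnerProductSpace ℂ H] [CompleteSpace H]
  {A : H → H → Prop} {J : ℝ → H →L[ℂ] H}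

theorem IsMAccretive.tendsto_resolvent (hA : IsMAccretive A)
    (hJ : ∀ᶠ l in atTop, IsResolvent A l (J l)) (x : H) :
    Tendsto (fun l => J l x) atTop (𝓝 x) := by
  have hc : ∀ᶠ l in atTop, ∀ y, ‖J l y‖ ≤ ‖y‖ := by
    filter_upwards [hJ, eventually_gt_atTop 0] with l h hl y
    exact hA.norm_resolvent_le h hl y
  refine tendsto_apply_of_dense (G := 1) hc hA.dense_domain (fun φ ⟨ψ, h⟩ => ?_) x
  rw [tendsto_iff_norm_sub_tendsto_zero]
  have h₁ : Tendsto (fun l : ℝ => l⁻¹ * ‖ψ‖) atTop (𝓝 0) := by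
    simpa using tendsto_inv_atTop_zero.mul_const ‖ψ‖
  refine squeeze_zero' (Eventually.of_forall fun _ => norm_nonneg _) ?_ h₁
  filter_upwards [hJ, eventually_gt_atTop 0] with l hl hl₀
  have h₂ := hA.resolvent_smul_sub hl hl₀ h
  have h₃ : φ - J l φ = l⁻¹ • J l ψ := by
    rw [← h₂, smul_smul, inv_mul_cancel₀ hl₀.ne', one_smul]
  rw [norm_sub_rev]
  change ‖φ - J l φ‖ ≤ _
  rw [h₃, norm_smul, Real.norm_of_nonneg (by positivity)]
  exact mul_le_mul_of_nonneg_left (hA.norm_resolvent_le hl hl₀ ψ) (by positivity)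

theorem IsMAccretive.tendsto_yosida (hA : IsMAccretive A)
    (hJ : ∀ᶠ l in atTop, IsResolvent A l (J l)) {φ ψ : H} (h : A φ ψ) :
    Tendsto (fun l => l • (J l φ - φ)) atTop (𝓝 (-ψ)) := by
  refine (hA.tendsto_resolvent hJ ψ).neg.congr' ?_
  filter_upwards [hJ, eventually_gt_atTop 0] with l hl hl₀
  rw [← hA.resolvent_smul_sub hl hl₀ h, ← smul_neg, neg_sub]

theorem IsMAccretive.norm_yosida_sub_le (hA : IsMAccretive A)
    {l m : ℝ} (hl : 0 < l) (hm : 0 < m)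
    (hJl : IsResolvent A l (J l)) (hJm : IsResolvent A m (J m)) (t : ℝ≥0) (x : H) :
    ‖yosidaSemigroup l (J l) t x - yosidaSemigroup m (J m) t x‖
      ≤ t * ‖l • (J l x - x) - m • (J m x - x)‖ := by
  have h := (isOpSemigroup_yosidaSemigroup l (J l)).norm_sub_le
    (isOpSemigroup_yosidaSemigroup m (J m)) (t := t) (M := 1) (fun s => ?_)
    (fun s _ y => ?_) (norm_yosidaSemigroup_apply_le hm (hA.norm_resolvent_le hJm hm))
    (hasGenerator_yosidaSemigroup l (J l) x) (hasGenerator_yosidaSemigroup m (J m) x)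
  · simpa using h
  · have h₁ : Commute (J m) (J l) :=
      hA.resolvent_commute hJl hl fun _ _ h => hA.resolvent_map hJm hm h
    exact commute_yosidaSemigroup_right (commute_yosidaSemigroup_right h₁ l s).symm m s
  · simpa using norm_yosidaSemigroup_apply_le hl (hA.norm_resolvent_le hJl hl) s y

end Resolvent

/-! ### Hille–Yosida generation, uniqueness and the exponential formula. -/

section Generation

variable {H : Type*} [NormedAddCommGroup H] [InnerProductSpace ℂ H] [CompleteSpace H]
  {A : H → H → Prop} {J : ℝ → H →L[ℂ] H} {S : ℝ≥0 → H →L[ℂ] H}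

theorem IsSemigroupGeneratedByNeg.exists_bound (hS : IsSemigroupGeneratedByNeg S A) (t : ℝ≥0) :
    ∃ M : ℝ, ∀ s ≤ t, ∀ y, ‖S s y‖ ≤ M * ‖y‖ := by
  obtain ⟨M, hM⟩ := banach_steinhaus (g := fun s : Set.Icc 0 t => S s) fun x => by
    obtain ⟨C, hC⟩ := (isCompact_Icc (a := (0 : ℝ≥0)) (b := t)).exists_bound_of_continuousOn
      (hS.continuous x).continuousOn
    exact ⟨C, fun s => hC s s.2⟩
  exact ⟨M, fun s hs y => (S s).le_of_opNorm_le (hM ⟨s, zero_le, hs⟩) y⟩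

omit [CompleteSpace H] in
theorem IsSemigroupGeneratedByNeg.map (hS : IsSemigroupGeneratedByNeg S A) (t : ℝ≥0) {φ ψ : H}
    (h : A φ ψ) : A (S t φ) (S t ψ) := by
  rw [hS.generator] at h ⊢
  have h₁ := ((S t).continuous.tendsto _).comp h
  rw [map_neg] at h₁
  refine h₁.congr fun s => ?_
  have h₂ : S t (S s φ) = S s (S t φ) :=
    congrArg (fun R : H →L[ℂ] H => R φ) (hS.isOpSemigroup.commute t s).eq
  simp only [Function.comp_apply]
  rw [(S t).map_smul_of_tower, map_sub, h₂]

/-- Every semigroup generated by `-A` is the limit of the same approximations; this yields both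
uniqueness and contractivity. Since contractivity is not yet available, the local bound `M` from
uniform boundedness is used. -/
theorem IsMAccretive.tendsto_yosidaSemigroup (hA : IsMAccretive A)
    (hJ : ∀ᶠ l in atTop, IsResolvent A l (J l)) (hS : IsSemigroupGeneratedByNeg S A)
    (t : ℝ≥0) (x : H) :
    Tendsto (fun l => yosidaSemigroup l (J l) t x) atTop (𝓝 (S t x)) := by
  refine tendsto_apply_of_dense ?_ hA.dense_domain (fun φ ⟨ψ, h⟩ => ?_) x
  · filter_upwards [hJ, eventually_gt_atTop 0] with l hl hl₀ y
    exact norm_yosidaSemigroup_apply_le hl₀ (hA.norm_resolvent_le hl hl₀) t y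
  · obtain ⟨M, hM⟩ := hS.exists_bound t
    rw [tendsto_iff_norm_sub_tendsto_zero]
    have h₁ : Tendsto (fun l => M * t * ‖-ψ - l • (J l φ - φ)‖) atTop (𝓝 0) := by
      simpa using (((tendsto_const_nhds (x := -ψ)).sub (hA.tendsto_yosida hJ h)).norm).const_mul
        (M * t)
    refine squeeze_zero' (Eventually.of_forall fun _ => norm_nonneg _) ?_ h₁
    filter_upwards [hJ, eventually_gt_atTop 0] with l hl hl₀
    rw [norm_sub_rev]
    exact hS.isOpSemigroup.norm_sub_le (isOpSemigroup_yosidaSemigroup l (J l))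
      (fun s => commute_yosidaSemigroup_right
        (hA.resolvent_commute hl hl₀ fun _ _ h => hS.map s h) l s)
      hM (norm_yosidaSemigroup_apply_le hl₀ (hA.norm_resolvent_le hl hl₀))
      ((hS.generator φ ψ).1 h) (hasGenerator_yosidaSemigroup l (J l) φ)

theorem IsMAccretive.semigroup_unique (hA : IsMAccretive A) {S' : ℝ≥0 → H →L[ℂ] H}
    (hS : IsSemigroupGeneratedByNeg S A) (hS' : IsSemigroupGeneratedByNeg S' A) : S = S' := by
  obtain ⟨J, hJ⟩ := hA.exists_isResolvent
  ext t x
  exact tendsto_nhds_unique (hA.tendsto_yosidaSemigroup hJ hS t x)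
    (hA.tendsto_yosidaSemigroup hJ hS' t x)

theorem IsMAccretive.norm_semigroup_le (hA : IsMAccretive A)
    (hS : IsSemigroupGeneratedByNeg S A) (t : ℝ≥0) (x : H) : ‖S t x‖ ≤ ‖x‖ := by
  obtain ⟨J, hJ⟩ := hA.exists_isResolvent
  refine le_of_tendsto (hA.tendsto_yosidaSemigroup hJ hS t x).norm ?_
  filter_upwards [hJ, eventually_gt_atTop 0] with l hl hl₀
  exact norm_yosidaSemigroup_apply_le hl₀ (hA.norm_resolvent_le hl hl₀) t x

/-- The exponential formula `S(t) = lim (1 + (t/k) A)⁻ᵏ`. -/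
theorem IsMAccretive.tendsto_resolvent_pow (hA : IsMAccretive A)
    (hJ : ∀ᶠ l in atTop, IsResolvent A l (J l)) (hS : IsSemigroupGeneratedByNeg S A)
    {t : ℝ≥0} (ht : 0 < t) (x : H) :
    Tendsto (fun k : ℕ => (J ((t / (k + 1 : ℝ≥0) : ℝ≥0) : ℝ)⁻¹ ^ (k + 1)) x) atTop
      (𝓝 (S t x)) := by
  have hlim : Tendsto (fun h : ℝ≥0 => (h : ℝ)⁻¹) (𝓝[>] 0) atTop := by
    refine tendsto_inv_nhdsGT_zero.comp (tendsto_nhdsWithin_iff.2 ⟨?_, ?_⟩)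
    · exact (NNReal.continuous_coe.tendsto 0).mono_left nhdsWithin_le_nhds
    · filter_upwards [self_mem_nhdsWithin] with t ht using NNReal.coe_pos.2 ht
  have hJ' : ∀ᶠ k : ℕ in atTop, IsResolvent A ((t / (k + 1 : ℝ≥0) : ℝ≥0) : ℝ)⁻¹
      (J ((t / (k + 1 : ℝ≥0) : ℝ≥0) : ℝ)⁻¹) :=
    (hlim.comp (tendsto_div_succ ht)).eventually hJ
  have hpos : ∀ k : ℕ, (0 : ℝ) < ((t / (k + 1 : ℝ≥0) : ℝ≥0) : ℝ)⁻¹ := fun k => by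
    have : (0 : ℝ) < t := ht
    positivity
  refine tendsto_apply_of_dense ?_ hA.dense_domain (fun φ ⟨ψ, h⟩ => ?_) x
  · filter_upwards [hJ'] with k hk y
    exact norm_pow_apply_le (hA.norm_resolvent_le hk (hpos k)) _ y
  · rw [tendsto_iff_norm_sub_tendsto_zero]
    have hgS : HasGenerator S φ (-ψ) := (hS.generator φ ψ).1 h
    -- `h ↦ J (1 / h)` is no semigroup, but it has the same derivative at `0` as the orbit of `S`,
    -- so the telescoping bound tends to `0`.
    have hgJ : HasGenerator (fun h : ℝ≥0 => J (h : ℝ)⁻¹) φ (-ψ) :=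
      (hA.tendsto_yosida hJ h).comp hlim
    have h₁ := hgS.norm_smul_sub_tendsto hgJ ht 1
    rw [sub_self, norm_zero, mul_zero] at h₁
    refine squeeze_zero' (Eventually.of_forall fun _ => norm_nonneg _) ?_ h₁
    filter_upwards [hJ'] with k hk
    have hkt : (k + 1) • (t / (k + 1 : ℝ≥0)) = t := by
      rw [nsmul_eq_mul]; push_cast; field_simp
    rw [norm_sub_rev]
    have h₂ := norm_pow_apply_sub_pow_apply_le (P := S (t / (k + 1 : ℝ≥0))) (M := 1)
      (hA.resolvent_commute hk (hpos k) fun _ _ h => hS.map _ h) φ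
      (hA.norm_resolvent_le hk (hpos k)) (k + 1)
      fun i _ y => by simpa using norm_pow_apply_le (hA.norm_semigroup_le hS _) i y
    rwa [← hS.isOpSemigroup.map_nsmul, hkt] at h₂

omit [CompleteSpace H] in
-- Maximality: the generator of a contraction semigroup is dissipative, and the range condition on
-- `A` leaves no room for a proper dissipative extension of `-A`.
theorem IsMAccretive.generator_iff (hA : IsMAccretive A) (hS : ∀ t x, ‖S t x‖ ≤ ‖x‖)
    (h : ∀ φ ψ, A φ ψ → HasGenerator S φ (-ψ)) (φ ψ : H) : A φ ψ ↔ HasGenerator S φ (-ψ) := by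
  refine ⟨h φ ψ, fun hφ => ?_⟩
  have hacc : ∀ x p : H, HasGenerator S x p → (inner ℂ x p).re ≤ 0 := by
    intro x p hp
    have h₁ : Tendsto (fun t : ℝ≥0 => (inner ℂ x ((t : ℝ)⁻¹ • (S t x - x))).re) (𝓝[>] 0)
        (𝓝 (inner ℂ x p).re) :=
      (Complex.continuous_re.tendsto _).comp (tendsto_const_nhds.inner hp)
    refine le_of_tendsto' h₁ fun t => ?_
    rw [inner_re_real_smul, inner_sub_right, Complex.sub_re]
    have h₃ : (inner ℂ x x).re = ‖x‖ ^ 2 := inner_self_eq_norm_sq (𝕜 := ℂ) x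
    have h₄ : (inner ℂ x (S t x)).re ≤ ‖x‖ * ‖S t x‖ := re_inner_le_norm (𝕜 := ℂ) x _
    have h₅ : ‖x‖ * ‖S t x‖ ≤ ‖x‖ * ‖x‖ := mul_le_mul_of_nonneg_left (hS t x) (norm_nonneg _)
    exact mul_nonpos_of_nonneg_of_nonpos (by positivity) (by nlinarith)
  obtain ⟨l, hl, hl₀⟩ := (hA.exists_resolvent.and (eventually_gt_atTop 0)).exists
  obtain ⟨φ', hφ'⟩ := hl (φ + l⁻¹ • ψ)
  have h₁ : HasGenerator S (φ - φ') (l • (φ - φ')) := by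
    have h₂ := hφ.sub (h _ _ hφ')
    have h₃ : -ψ - -(l • (φ + l⁻¹ • ψ - φ')) = l • (φ - φ') := by
      rw [add_sub_right_comm, smul_add, smul_smul, mul_inv_cancel₀ hl₀.ne', one_smul]; abel
    rw [h₃] at h₂
    refine h₂.congr fun t => ?_
    rw [← smul_sub, map_sub]; congr 1; abel
  have h₂ := hacc _ _ h₁
  rw [inner_re_real_smul] at h₂
  have h₃ : (inner ℂ (φ - φ') (φ - φ')).re = ‖φ - φ'‖ ^ 2 := inner_self_eq_norm_sq (𝕜 := ℂ) _
  rw [h₃] at h₂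
  have h₄ : ‖φ - φ'‖ ^ 2 ≤ 0 := by
    by_contra hcon
    push Not at hcon
    nlinarith [mul_pos hl₀ hcon]
  have h₅ : φ - φ' = 0 :=
    norm_eq_zero.1 (pow_eq_zero_iff two_ne_zero |>.1 (le_antisymm h₄ (sq_nonneg _)))
  rw [← sub_eq_zero.1 h₅, add_sub_cancel_left, smul_smul, mul_inv_cancel₀ hl₀.ne', one_smul] at hφ'
  exact hφ'

theorem IsMAccretive.exists_semigroup (hA : IsMAccretive A) :
    ∃ S : ℝ≥0 → H →L[ℂ] H, IsSemigroupGeneratedByNeg S A := by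
  obtain ⟨J, hJ⟩ := hA.exists_isResolvent
  have hE : ∀ᶠ l in atTop, 0 < l ∧ IsResolvent A l (J l) := (eventually_gt_atTop 0).and hJ
  set E : ℕ → ℝ≥0 → H →L[ℂ] H := fun n => yosidaSemigroup (n : ℝ) (J n) with hEdef
  have hN : ∀ᶠ n : ℕ in atTop, (0 : ℝ) < n ∧ IsResolvent A n (J n) :=
    tendsto_natCast_atTop_atTop.eventually hE
  have hY : ∀ {φ ψ}, A φ ψ → Tendsto (fun n : ℕ => (n : ℝ) • (J n φ - φ)) atTop (𝓝 (-ψ)) :=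
    fun h => (hA.tendsto_yosida hJ h).comp tendsto_natCast_atTop_atTop
  have hcontr : ∀ᶠ n in atTop, ∀ t y, ‖E n t y‖ ≤ ‖y‖ := by
    filter_upwards [hN] with n hn t y
    exact norm_yosidaSemigroup_apply_le hn.1 (hA.norm_resolvent_le hn.2 hn.1) t y
  have hcauchyD : ∀ t φ ψ, A φ ψ → CauchySeq fun n => E n t φ := by
    intro t φ ψ h
    rw [Metric.cauchySeq_iff]
    intro ε hε
    have hc := Metric.cauchySeq_iff.1 (hY h).cauchySeq (ε / (t + 1)) (by positivity)
    obtain ⟨N, hc⟩ := hc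
    obtain ⟨N', hN'⟩ := eventually_atTop.1 hN
    refine ⟨max N N', fun m hm n hn => ?_⟩
    have hm' := hN' m (le_of_max_le_right hm)
    have hn' := hN' n (le_of_max_le_right hn)
    have h₁ := hc m (le_of_max_le_left hm) n (le_of_max_le_left hn)
    rw [dist_eq_norm] at h₁ ⊢
    have h₂ : (t + 1 : ℝ) * (ε / (t + 1)) = ε := by field_simp
    calc ‖E m t φ - E n t φ‖ ≤ t * ‖(m : ℝ) • (J m φ - φ) - (n : ℝ) • (J n φ - φ)‖ :=
          hA.norm_yosida_sub_le hm'.1 hn'.1 hm'.2 hn'.2 t φ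
      _ ≤ (t + 1) * ‖(m : ℝ) • (J m φ - φ) - (n : ℝ) • (J n φ - φ)‖ := by gcongr; simp
      _ < (t + 1) * (ε / (t + 1)) := by gcongr
      _ = ε := h₂
  have hcauchy : ∀ t x, CauchySeq fun n => E n t x := by
    intro t x
    rw [Metric.cauchySeq_iff]
    intro ε hε
    obtain ⟨φ, ⟨ψ, h⟩, hφ⟩ := Metric.mem_closure_iff.1 (hA.dense_domain x) (ε / 3) (by positivity)
    obtain ⟨N, hc⟩ := Metric.cauchySeq_iff.1 (hcauchyD t φ ψ h) (ε / 3) (by positivity)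
    obtain ⟨N', hN'⟩ := eventually_atTop.1 hcontr
    refine ⟨max N N', fun m hm n hn => ?_⟩
    have hm' := hN' m (le_of_max_le_right hm) t (x - φ)
    have hn' := hN' n (le_of_max_le_right hn) t (φ - x)
    have h₁ := hc m (le_of_max_le_left hm) n (le_of_max_le_left hn)
    rw [dist_eq_norm] at h₁ hφ ⊢
    rw [norm_sub_rev φ x] at hn'
    have h₂ : E m t x - E n t x = E m t (x - φ) + (E m t φ - E n t φ) + E n t (φ - x) := by simp
    rw [h₂]
    calc _ ≤ ‖E m t (x - φ)‖ + ‖E m t φ - E n t φ‖ + ‖E n t (φ - x)‖ := norm_add₃_le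
      _ < ε := by linarith
  have hlim : ∀ t, ∃ L : H →L[ℂ] H, ∀ x, Tendsto (fun n => E n t x) atTop (𝓝 (L x)) := by
    intro t
    choose f hf using fun x => cauchySeq_tendsto_of_complete (hcauchy t x)
    exact ⟨continuousLinearMapOfTendsto (fun n => E n t) (tendsto_pi_nhds.2 hf), hf⟩
  choose S hS using hlim
  have hSc : ∀ t x, ‖S t x‖ ≤ ‖x‖ := fun t x =>
    le_of_tendsto (hS t x).norm (hcontr.mono fun n hn => hn t x)
  have hzero : S 0 = 1 := by
    ext x
    refine tendsto_nhds_unique (hS 0 x) ?_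
    simp [hEdef, (isOpSemigroup_yosidaSemigroup _ _).map_zero]
  have hadd : ∀ s t, S (s + t) = S s * S t := by
    intro s t
    ext x
    refine tendsto_nhds_unique (hS (s + t) x) ?_
    have h₁ : Tendsto (fun n => E n s (E n t x - S t x)) atTop (𝓝 0) := by
      rw [tendsto_zero_iff_norm_tendsto_zero]
      refine squeeze_zero' (Eventually.of_forall fun _ => norm_nonneg _)
        (hcontr.mono fun n hn => hn s _) (tendsto_iff_norm_sub_tendsto_zero.1 (hS t x))
    have h₂ := h₁.add (hS s (S t x))
    rw [zero_add] at h₂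
    refine h₂.congr fun n => ?_
    rw [map_sub, sub_add_cancel, hEdef]
    simp only [(isOpSemigroup_yosidaSemigroup _ _).map_add]
    rfl
  -- The factor `t` on the right survives the limit; after division by `t` it controls the
  -- difference quotients uniformly in `t`.
  have hest : ∀ {φ ψ}, A φ ψ → ∀ᶠ n : ℕ in atTop, ∀ t,
      ‖S t φ - E n t φ‖ ≤ t * ‖-ψ - (n : ℝ) • (J n φ - φ)‖ := by
    intro φ ψ h
    filter_upwards [hN] with n hn t
    refine le_of_tendsto_of_tendsto ((hS t φ).sub_const _).norm
      ((((hY h).sub_const _).norm).const_mul (t : ℝ)) ?_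
    filter_upwards [hN] with m hm
    exact hA.norm_yosida_sub_le hm.1 hn.1 hm.2 hn.2 t φ
  have hlip : ∀ {φ ψ}, A φ ψ → ∀ t, ‖S t φ - φ‖ ≤ t * ‖ψ‖ := by
    intro φ ψ h t
    have h₁ : Tendsto (fun n => ‖E n t φ - φ‖) atTop (𝓝 ‖S t φ - φ‖) :=
      ((hS t φ).sub_const φ).norm
    have h₂ : Tendsto (fun n : ℕ => t * ‖(n : ℝ) • (J n φ - φ)‖) atTop (𝓝 (t * ‖-ψ‖)) :=
      ((hY h).norm).const_mul (t : ℝ)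
    rw [norm_neg] at h₂
    refine le_of_tendsto_of_tendsto h₁ h₂ ?_
    filter_upwards [hcontr] with n hn
    -- Comparison with the constant semigroup, whose generator is `0`.
    have h₃ := (isOpSemigroup_yosidaSemigroup (n : ℝ) (J n)).norm_sub_le isOpSemigroup_one
      (fun s => Commute.one_right _) (t := t) (M := 1) (fun s _ y => by simpa using hn s y)
      (fun _ _ => le_rfl) (hasGenerator_yosidaSemigroup (n : ℝ) (J n) φ) (hasGenerator_one φ)
    simpa using h₃
  have hlip₂ : ∀ {φ ψ}, A φ ψ → ∀ s t, s ≤ t → ‖S t φ - S s φ‖ ≤ dist t s * ‖ψ‖ := by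
    intro φ ψ h s t hst
    have h₁ : S t φ - S s φ = S s (S (t - s) φ - φ) := by
      have h₂ : S t = S s * S (t - s) := by rw [← hadd, add_tsub_cancel_of_le hst]
      rw [map_sub, h₂]; rfl
    rw [h₁]
    refine (hSc _ _).trans ((hlip h _).trans (le_of_eq ?_))
    rw [NNReal.dist_eq, ← NNReal.coe_sub hst, abs_of_nonneg (NNReal.coe_nonneg _)]
  have hcontD : ∀ {φ ψ}, A φ ψ → Continuous fun t => S t φ := by
    intro φ ψ h
    refine LipschitzWith.continuous (K := ‖ψ‖₊) (LipschitzWith.of_dist_le_mul fun s t => ?_)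
    rw [mul_comm, coe_nnnorm]
    rcases le_total s t with hst | hst
    · rw [dist_comm, dist_comm s t, dist_eq_norm]; exact hlip₂ h s t hst
    · rw [dist_eq_norm]; exact hlip₂ h t s hst
  have hcont : ∀ x, Continuous fun t => S t x := by
    intro x
    refine continuous_of_uniform_approx_of_continuous fun u hu => ?_
    obtain ⟨ε, hε, hu⟩ := Metric.mem_uniformity_dist.1 hu
    obtain ⟨φ, ⟨ψ, h⟩, hφ⟩ := Metric.mem_closure_iff.1 (hA.dense_domain x) ε hε
    refine ⟨_, hcontD h, fun t => hu ?_⟩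
    rw [dist_eq_norm, ← map_sub]
    exact (hSc _ _).trans_lt (by rwa [← dist_eq_norm])
  have hgen : ∀ φ ψ, A φ ψ → HasGenerator S φ (-ψ) := by
    intro φ ψ h
    rw [HasGenerator, Metric.tendsto_nhds]
    intro ε hε
    have hclose := Metric.tendsto_nhds.1 (hY h) (ε / 3) (by positivity)
    obtain ⟨n, hn₁, hn₂⟩ := (hclose.and (hest h)).exists
    have hn₃ := Metric.tendsto_nhds.1 (hasGenerator_yosidaSemigroup (n : ℝ) (J n) φ) (ε / 3)
      (by positivity)
    filter_upwards [hn₃, self_mem_nhdsWithin] with t ht ht₀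
    have ht₀ : (0 : ℝ) < t := NNReal.coe_pos.2 ht₀
    have h₁ : ‖(t : ℝ)⁻¹ • (S t φ - φ) - (t : ℝ)⁻¹ • (E n t φ - φ)‖
        ≤ ‖-ψ - (n : ℝ) • (J n φ - φ)‖ := by
      rw [← smul_sub, sub_sub_sub_cancel_right, norm_smul, Real.norm_of_nonneg (by positivity),
        inv_mul_le_iff₀ ht₀]
      exact hn₂ t
    rw [dist_eq_norm] at hn₁ ht ⊢
    rw [norm_sub_rev] at h₁
    have h₂ : (t : ℝ)⁻¹ • (S t φ - φ) - -ψ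
        = -((t : ℝ)⁻¹ • (E n t φ - φ) - (t : ℝ)⁻¹ • (S t φ - φ))
          + ((t : ℝ)⁻¹ • (E n t φ - φ) - (n : ℝ) • (J n φ - φ))
          + ((n : ℝ) • (J n φ - φ) - -ψ) := by abel
    rw [h₂]
    refine norm_add₃_le.trans_lt ?_
    rw [norm_neg]
    rw [norm_sub_rev (-ψ)] at h₁
    linarith
  exact ⟨S, hzero, hadd, hcont, hA.generator_iff hSc hgen⟩

theorem IsMAccretive.existsUnique_semigroup (hA : IsMAccretive A) :
    ∃! S : ℝ≥0 → H →L[ℂ] H, IsSemigroupGeneratedByNeg S A := by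
  obtain ⟨S, hS⟩ := hA.exists_semigroup
  exact ⟨S, hS, fun S' hS' => hA.semigroup_unique hS' hS⟩

end Generation

/-! ### Invariant sets: resolvents versus semigroups. -/

section Invariance

variable {H K : Type*} [NormedAddCommGroup H] [InnerProductSpace ℂ H] [CompleteSpace H]
  [NormedAddCommGroup K] [InnerProductSpace ℂ K] [CompleteSpace K]
  {A : H → H → Prop} {B : K → K → Prop} {S : ℝ≥0 → H →L[ℂ] H} {T : ℝ≥0 → K →L[ℂ] K}
  {C : Set (H × K)}

theorem semigroup_invariant (hA : IsMAccretive A) (hB : IsMAccretive B)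
    (hS : IsSemigroupGeneratedByNeg S A) (hT : IsSemigroupGeneratedByNeg T B)
    {J : ℝ → H →L[ℂ] H} {L : ℝ → K →L[ℂ] K}
    (hJ : ∀ᶠ l in atTop, IsResolvent A l (J l)) (hL : ∀ᶠ l in atTop, IsResolvent B l (L l))
    (hC : IsClosed C) (h : ∀ l > 0, IsResolvent A l (J l) → IsResolvent B l (L l) →
      ∀ p ∈ C, (J l p.1, L l p.2) ∈ C) (t : ℝ≥0) {p : H × K} (hp : p ∈ C) :
    (S t p.1, T t p.2) ∈ C := by
  rcases eq_or_lt_of_le (zero_le : 0 ≤ t) with rfl | ht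
  · rw [hS.map_zero, hT.map_zero]; exact hp
  obtain ⟨l₀, hl₀⟩ := eventually_atTop.1 ((hJ.and hL).and (eventually_gt_atTop 0))
  have hlim := (hA.tendsto_resolvent_pow hJ hS ht p.1).prodMk_nhds
    (hB.tendsto_resolvent_pow hL hT ht p.2)
  refine hC.mem_of_tendsto hlim ?_
  have hpos : (0 : ℝ) < t := ht
  -- For these `k` the parameter `(k + 1) / t` is at least `l₀`, where `J` and `L` really are
  -- resolvents.
  filter_upwards [eventually_ge_atTop ⌈l₀ * t⌉₊] with k hk
  have hk' : l₀ ≤ ((t / (k + 1 : ℝ≥0) : ℝ≥0) : ℝ)⁻¹ := by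
    have h₁ : l₀ * t ≤ k := (Nat.le_ceil _).trans (by exact_mod_cast hk)
    push_cast
    rw [inv_div, le_div_iff₀ hpos]
    linarith
  obtain ⟨⟨h₁, h₂⟩, h₃⟩ := hl₀ _ hk'
  generalize k + 1 = n
  induction n with
  | zero => exact hp
  | succ n ih => rw [pow_succ', pow_succ']; exact h _ h₃ h₁ h₂ _ ih

/-- Iterates whose limit solves `y = c f + q Q y`. -/
def affineIterate (c q : ℝ) (Q : H →L[ℂ] H) (f : H) : ℕ → H
  | 0 => f
  | n + 1 => c • f + q • Q (affineIterate c q Q f n)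

theorem IsMAccretive.affineIterate_near (hA : IsMAccretive A)
    (hS : IsSemigroupGeneratedByNeg S A) {l : ℝ} (hl : 0 < l) {f φ : H}
    (hφ : A φ (l • (f - φ))) {ε : ℝ} (hε : 0 < ε) :
    ∀ᶠ t : ℝ≥0 in 𝓝[>] 0, ∀ᶠ n in atTop,
      ‖affineIterate (l * t * (1 + l * t)⁻¹) (1 + l * t)⁻¹ (S t) f n - φ‖ < ε := by
  -- Replacing `A` by `(1 - S t) / t` in `A y = l (f - y)` gives `y = c f + q S(t) y` with `q = 1 /
  -- (1 + l t)` and `c = l t q`. This is a strict contraction, which `φ` satisfies up to the small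
  -- defect `q t r`.
  have h₁ := Metric.tendsto_nhds.1 ((hS.generator _ _).1 hφ) (l * (ε / 2)) (by positivity)
  filter_upwards [h₁, self_mem_nhdsWithin] with t ht ht₀
  have ht₀ : (0 : ℝ) < t := NNReal.coe_pos.2 ht₀
  set q : ℝ := (1 + l * t)⁻¹ with hq
  have hlt : 0 < l * t := mul_pos hl ht₀
  have hq₀ : 0 < q := by positivity
  have hq₁ : q < 1 := inv_lt_one_of_one_lt₀ (by linarith)
  have hqq : q * (1 + l * t) = 1 := inv_mul_cancel₀ (by positivity)
  rw [dist_eq_norm] at ht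
  set r : H := (t : ℝ)⁻¹ • (S t φ - φ) - -(l • (f - φ)) with hr
  have hstep : ∀ y : H, (l * t * q) • f + q • S t y - φ = q • S t (y - φ) + (q * t) • r := by
    intro y
    have h₂ : φ = (q * (1 + l * t)) • φ := by rw [hqq, one_smul]
    have h₃ : (q * t) • r = q • (S t φ - φ) + (l * t * q) • (f - φ) := by
      rw [hr, sub_neg_eq_add, smul_add, smul_smul, smul_smul]
      congr 2
      · field_simp
      · ring
    rw [h₃, map_sub]
    nth_rewrite 1 [h₂]
    module
  have hbound : ∀ n, ‖affineIterate (l * t * q) q (S t) f n - φ‖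
      ≤ q ^ n * ‖f - φ‖ + ‖r‖ / l := by
    intro n
    induction n with
    | zero => simp [affineIterate]; positivity
    | succ n ih =>
      rw [affineIterate, hstep]
      calc _ ≤ ‖q • S t (affineIterate (l * t * q) q (S t) f n - φ)‖ + ‖(q * t) • r‖ :=
            norm_add_le _ _
        _ ≤ q * (q ^ n * ‖f - φ‖ + ‖r‖ / l) + q * t * ‖r‖ := by
            rw [norm_smul, norm_smul, Real.norm_of_nonneg hq₀.le,
              Real.norm_of_nonneg (by positivity)]
            gcongr
            exact (hA.norm_semigroup_le hS t _).trans ih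
        _ = q ^ (n + 1) * ‖f - φ‖ + (q * (1 + l * t)) * (‖r‖ / l) := by
            field_simp; ring
        _ = _ := by rw [hqq, one_mul]
  have hr' : ‖r‖ / l < ε / 2 := by rw [div_lt_iff₀ hl]; linarith
  have hpow : Tendsto (fun n : ℕ => q ^ n * ‖f - φ‖) atTop (𝓝 0) := by
    simpa using (tendsto_pow_atTop_nhds_zero_of_lt_one hq₀.le hq₁).mul_const ‖f - φ‖
  filter_upwards [hpow.eventually (gt_mem_nhds (half_pos hε))] with n hn
  exact (hbound n).trans_lt (by linarith)

/-- The coefficients of the affine iteration sum to `1`, so each iterate is a convex combination of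
`p` and the semigroup image of the previous iterate. This does the work of the Laplace transform. -/
theorem resolvent_invariant (hA : IsMAccretive A) (hB : IsMAccretive B)
    (hS : IsSemigroupGeneratedByNeg S A) (hT : IsSemigroupGeneratedByNeg T B)
    {J : H →L[ℂ] H} {L : K →L[ℂ] K} {l : ℝ} (hl : 0 < l)
    (hJ : IsResolvent A l J) (hL : IsResolvent B l L)
    (hC : IsClosed C) (hconv : Convex ℝ C)
    (h : ∀ t, ∀ p ∈ C, (S t p.1, T t p.2) ∈ C) {p : H × K} (hp : p ∈ C) :
    (J p.1, L p.2) ∈ C := by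
  rw [← hC.closure_eq, Metric.mem_closure_iff]
  intro ε hε
  obtain ⟨t, ht⟩ := ((hA.affineIterate_near hS hl (hJ p.1) hε).and
    (hB.affineIterate_near hT hl (hL p.2) hε)).exists
  obtain ⟨n, hn₁, hn₂⟩ := (ht.1.and ht.2).exists
  refine ⟨(affineIterate (l * t * (1 + l * t)⁻¹) (1 + l * t)⁻¹ (S t) p.1 n,
    affineIterate (l * t * (1 + l * t)⁻¹) (1 + l * t)⁻¹ (T t) p.2 n), ?_, ?_⟩
  rotate_left
  · rw [Prod.dist_eq, dist_comm, dist_eq_norm, dist_comm (L p.2), dist_eq_norm]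
    exact max_lt hn₁ hn₂
  · clear hn₁ hn₂
    induction n with
    | zero => exact hp
    | succ n ih =>
      have ht₀ : (0 : ℝ) ≤ t := t.2
      have hlt : 0 ≤ l * t := by positivity
      exact hconv hp (h t _ ih) (by positivity) (by positivity) (by field_simp; ring)

end Invariance

/-! ### Lax–Milgram and m-accretivity of the operator associated with a form. -/

section Forms

variable {V H : Type*} [NormedAddCommGroup V] [InnerProductSpace ℂ V]
  [NormedAddCommGroup H] [InnerProductSpace ℂ H]

theorem Form.IsElliptic.exists_nonneg {a : Form V} {j : V →L[ℂ] H} (h : a.IsElliptic j) :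
    ∃ ω μ : ℝ, 0 ≤ ω ∧ 0 < μ ∧ ∀ u : V, μ * ‖u‖ ^ 2 ≤ (a u u).re + ω * ‖j u‖ ^ 2 := by
  obtain ⟨ω, μ, hμ, h⟩ := h
  refine ⟨max ω 0, μ, le_max_right _ _, hμ, fun u => (h u).trans ?_⟩
  gcongr
  exact le_max_left _ _

theorem exists_of_real_coercive [CompleteSpace V] (B : V →L[ℝ] V →L[ℝ] ℝ) (F : V →L[ℝ] ℝ)
    {μ : ℝ} (hμ : 0 < μ) (hB : ∀ u, μ * ‖u‖ * ‖u‖ ≤ B u u) : ∃ u, ∀ v, B u v = F v := by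
  let _ : InnerProductSpace ℝ V := InnerProductSpace.rclikeToReal ℂ V
  have hcoer : IsCoercive B := ⟨μ, hμ, hB⟩
  refine ⟨hcoer.continuousLinearEquivOfBilin.symm ((InnerProductSpace.toDual ℝ V).symm F),
    fun v => ?_⟩
  rw [← hcoer.continuousLinearEquivOfBilin_apply, ContinuousLinearEquiv.apply_symm_apply,
    InnerProductSpace.toDual_symm_apply]

theorem Form.exists_of_coercive [CompleteSpace V] {a : Form V} (ha : a.IsBounded)
    {j : V →L[ℂ] H} {l μ : ℝ} (hμ : 0 < μ)
    (hc : ∀ u, μ * ‖u‖ ^ 2 ≤ (a u u).re + l * ‖j u‖ ^ 2) (f : H) :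
    ∃ u : V, ∀ v : V, a u v = inner ℂ (j v) (f - l • j u) := by
  obtain ⟨M, hM, ha⟩ := ha
  have hsmul : ∀ (c : ℝ) (x : V), c • x = (c : ℂ) • x := fun c x => (Complex.coe_smul c x).symm
  have hinner : ∀ u v, ‖inner ℂ (j v) (j u)‖ ≤ ‖j‖ ^ 2 * ‖u‖ * ‖v‖ := fun u v => by
    calc _ ≤ ‖j v‖ * ‖j u‖ := norm_inner_le_norm _ _
      _ ≤ (‖j‖ * ‖v‖) * (‖j‖ * ‖u‖) := by gcongr <;> exact j.le_opNorm _
      _ = _ := by ring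
  let B : V →L[ℝ] V →L[ℝ] ℝ := LinearMap.mkContinuous₂
    (LinearMap.mk₂ ℝ (fun u v => (a u v).re + l * (inner ℂ (j v) (j u)).re)
      (fun u u' v => by simp; ring)
      (fun c u v => by rw [hsmul]; simp; ring)
      (fun u v v' => by simp; ring)
      (fun c u v => by rw [hsmul, map_smulₛₗ]; simp; ring))
    (M + |l| * ‖j‖ ^ 2) fun u v => by
      rw [LinearMap.mk₂_apply, Real.norm_eq_abs]
      calc _ ≤ |(a u v).re| + |l| * |(inner ℂ (j v) (j u)).re| := by
            rw [← abs_mul]; exact abs_add_le _ _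
        _ ≤ M * ‖u‖ * ‖v‖ + |l| * (‖j‖ ^ 2 * ‖u‖ * ‖v‖) := by
            gcongr
            · exact (Complex.abs_re_le_norm _).trans (ha u v)
            · exact (Complex.abs_re_le_norm _).trans (hinner u v)
        _ = _ := by ring
  have hB : ∀ u v, B u v = (a u v).re + l * (inner ℂ (j v) (j u)).re := fun _ _ => rfl
  have hcoer : ∀ u, μ * ‖u‖ * ‖u‖ ≤ B u u := fun u => by
    have h₁ : (inner ℂ (j u) (j u)).re = ‖j u‖ ^ 2 := inner_self_eq_norm_sq (𝕜 := ℂ) _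
    rw [hB, h₁, mul_assoc, ← sq]
    exact hc u
  let F : V →L[ℝ] ℝ := LinearMap.mkContinuous
    ⟨⟨fun v => (inner ℂ (j v) f).re, fun v v' => by simp⟩,
      fun c v => by rw [hsmul]; simp⟩ (‖j‖ * ‖f‖) fun v => by
        refine (Complex.abs_re_le_norm _).trans ((norm_inner_le_norm _ _).trans ?_)
        calc _ ≤ (‖j‖ * ‖v‖) * ‖f‖ := by gcongr; exact j.le_opNorm _
          _ = _ := by ring
  have hF : ∀ v, F v = (inner ℂ (j v) f).re := fun _ => rfl
  obtain ⟨u, hu⟩ := exists_of_real_coercive B F hμ hcoer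
  refine ⟨u, ?_⟩
  have hre : ∀ v, (a u v).re = (inner ℂ (j v) (f - l • j u)).re := fun v => by
    have h₁ := hu v
    rw [hB, hF] at h₁
    rw [inner_sub_right, Complex.sub_re, inner_re_real_smul]
    linarith
  intro v
  refine Complex.ext (hre v) ?_
  -- The real Lax–Milgram theorem gave only real parts; testing with `i v` recovers the imaginary
  -- parts.
  have h₁ := hre (Complex.I • v)
  rw [map_smulₛₗ, map_smul, inner_smul_left] at h₁
  generalize inner ℂ (j v) (f - l • j u) = z at h₁ ⊢
  simpa using h₁

theorem Form.isMAccretive_assocOp [CompleteSpace V] {a : Form V} (ha : a.IsBounded)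
    (hacc : a.IsAccretive) {j : V →L[ℂ] H} (hj : DenseRange j) (hell : a.IsElliptic j) :
    IsMAccretive (a.AssocOp j) := by
  obtain ⟨ω, μ, hω, hμ, hell⟩ := hell.exists_nonneg
  refine ⟨?_, ?_, ?_, ?_, ?_⟩
  · rintro _ ψ _ ψ' ⟨u, rfl, hu⟩ ⟨u', rfl, hu'⟩
    exact ⟨u + u', map_add _ _ _, fun v => by
      rw [map_add, LinearMap.add_apply, hu, hu', inner_add_right]⟩
  · rintro c _ ψ ⟨u, rfl, hu⟩
    exact ⟨c • u, map_smul _ _ _, fun v => by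
      rw [map_smul, LinearMap.smul_apply, hu, inner_smul_right, smul_eq_mul]⟩
  · rintro φ ψ ψ' ⟨u, hju, hu⟩ ⟨u', hju', hu'⟩
    have h₀ : j (u - u') = 0 := by rw [map_sub, hju, hju', sub_self]
    have h₁ : ∀ v, a (u - u') v = inner ℂ (j v) (ψ - ψ') := fun v => by
      rw [map_sub, LinearMap.sub_apply, hu, hu', inner_sub_right]
    have h₂ := hell (u - u')
    rw [h₁, h₀, inner_zero_left, norm_zero] at h₂
    -- Although `j` may fail to be injective, ellipticity kills any difference of two solutions in
    -- its kernel.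
    have h₃ : ‖u - u'‖ ^ 2 ≤ 0 := by
      simp only [Complex.zero_re] at h₂
      by_contra hcon
      push Not at hcon
      nlinarith [mul_pos hμ hcon]
    have h₄ : u - u' = 0 := norm_eq_zero.1
      (pow_eq_zero_iff two_ne_zero |>.1 (le_antisymm h₃ (sq_nonneg _)))
    have h₅ : ∀ x : H, inner ℂ x (ψ - ψ') = 0 := by
      refine fun x => hj.induction_on (p := fun x : H => inner ℂ x (ψ - ψ') = 0) x ?_ fun v => ?_
      · exact isClosed_eq (by fun_prop) continuous_const
      · rw [← h₁, h₄, map_zero, LinearMap.zero_apply]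
    exact sub_eq_zero.1 (inner_self_eq_zero.1 (h₅ (ψ - ψ')))
  · rintro _ ψ ⟨u, rfl, hu⟩
    rw [← hu]; exact hacc u
  · filter_upwards [eventually_ge_atTop ω] with l hl f
    obtain ⟨u, hu⟩ := Form.exists_of_coercive ha (l := l) hμ
      (fun u => (hell u).trans (by gcongr)) (l • f)
    exact ⟨j u, u, rfl, fun v => by rw [hu, smul_sub]⟩

end Forms

/-! ### Weak limits of bounded families along ultrafilters. -/

section WeakLimits

variable {V : Type*} [NormedAddCommGroup V] [InnerProductSpace ℂ V] [CompleteSpace V]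

theorem exists_weak_limit {α : Type*} (𝒰 : Ultrafilter α) {x : α → V} {R : ℝ}
    (hx : ∀ᶠ n in 𝒰, ‖x n‖ ≤ R) :
    ∃ w : V, ∀ y, Tendsto (fun n => inner ℂ (x n) y) 𝒰 (𝓝 (inner ℂ w y)) := by
  have hbd : ∀ y, ∀ᶠ n in 𝒰, ‖inner ℂ (x n) y‖ ≤ R * ‖y‖ := fun y => hx.mono fun n hn =>
    (norm_inner_le_norm _ _).trans (by gcongr)
  have h : ∀ y, ∃ z : ℂ, Tendsto (fun n => inner ℂ (x n) y) 𝒰 (𝓝 z) := fun y => by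
    obtain ⟨z, -, hz⟩ := (isCompact_closedBall (0 : ℂ) (R * ‖y‖)).ultrafilter_le_nhds
      (𝒰.map fun n => inner ℂ (x n) y)
      (le_principal_iff.2 ((hbd y).mono fun n hn => by simpa using hn))
    exact ⟨z, hz⟩
  choose L hL using h
  let Λ : V →L[ℂ] ℂ := LinearMap.mkContinuous
    ⟨⟨L, fun y y' => tendsto_nhds_unique (hL _)
        (((hL y).add (hL y')).congr fun n => (inner_add_right _ _ _).symm)⟩,
      fun c y => tendsto_nhds_unique (hL _)
        (((hL y).const_mul c).congr fun n => (inner_smul_right _ _ _).symm)⟩ R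
    fun y => le_of_tendsto (hL y).norm (hbd y)
  refine ⟨(InnerProductSpace.toDual ℂ V).symm Λ, fun y => ?_⟩
  rw [InnerProductSpace.toDual_symm_apply]
  exact hL y

theorem tendsto_of_weak {α : Type*} {𝒰 : Filter α} {x : α → V} {w : V}
    (h : ∀ y, Tendsto (fun n => inner ℂ (x n) y) 𝒰 (𝓝 (inner ℂ w y))) (Λ : V →L[ℂ] ℂ) :
    Tendsto (fun n => Λ (x n)) 𝒰 (𝓝 (Λ w)) := by
  have h₁ := (Complex.continuous_conj.tendsto _).comp (h ((InnerProductSpace.toDual ℂ V).symm Λ))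
  have h₂ : ∀ y, (starRingEnd ℂ) (inner ℂ y ((InnerProductSpace.toDual ℂ V).symm Λ)) = Λ y :=
    fun y => by rw [inner_conj_symm, InnerProductSpace.toDual_symm_apply]
  rw [h₂] at h₁
  exact h₁.congr fun n => h₂ _

theorem Form.tendsto_of_weak {α : Type*} {𝒰 : Filter α} {x : α → V} {w : V} {a : Form V}
    (ha : a.IsBounded)
    (h : ∀ y, Tendsto (fun n => inner ℂ (x n) y) 𝒰 (𝓝 (inner ℂ w y))) (y : V) :
    Tendsto (fun n => a (x n) y) 𝒰 (𝓝 (a w y)) ∧ Tendsto (fun n => a y (x n)) 𝒰 (𝓝 (a y w)) := by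
  obtain ⟨M, hM, ha⟩ := ha
  constructor
  · let Λ : V →L[ℂ] ℂ := LinearMap.mkContinuous
      ⟨⟨fun v => a v y, fun v v' => by simp⟩, fun c v => by simp⟩ (M * ‖y‖)
      fun v => (ha v y).trans (le_of_eq (by ring))
    exact FormDomination.tendsto_of_weak h Λ
  · let Λ : V →L[ℂ] ℂ := LinearMap.mkContinuous
      ⟨⟨fun v => (starRingEnd ℂ) (a y v), fun v v' => by simp⟩, fun c v => by simp⟩ (M * ‖y‖)
      fun v => by simpa using ha y v
    have h₁ := (Complex.continuous_conj.tendsto _).comp (FormDomination.tendsto_of_weak h Λ)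
    simpa [Λ, Function.comp_def] using h₁

end WeakLimits

/-! ### The form criterion for invariance of a set admitting projections. -/

section Projection

variable {U V H K : Type*} [NormedAddCommGroup U] [InnerProductSpace ℂ U]
  [NormedAddCommGroup V] [InnerProductSpace ℂ V]
  [NormedAddCommGroup H] [InnerProductSpace ℂ H] [NormedAddCommGroup K] [InnerProductSpace ℂ K]

/-- `p` is the orthogonal projection of `q` onto the convex set `C` in the Hilbert sum. -/
def IsProj (C : Set (H × K)) (p q : H × K) : Prop :=
  p ∈ C ∧ ∀ r ∈ C,
    (inner ℂ (r.1 - p.1) (q.1 - p.1)).re + (inner ℂ (r.2 - p.2) (q.2 - p.2)).re ≤ 0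

variable {a : Form U} {b : Form V} {j₁ : U →L[ℂ] H} {j₂ : V →L[ℂ] K} {C : Set (H × K)}

theorem Form.IsAccretive.re_le_of_resolvent (hb : b.IsAccretive) {j : V →L[ℂ] H} {l : ℝ}
    {x w : V} {f : H} (hx : ∀ y, b x y = inner ℂ (j y) (l • (f - j x))) :
    (b w (x - w)).re ≤ l * ((inner ℂ (f - j w) (j x - j w)).re - ‖j x - j w‖ ^ 2) := by
  have h₁ : (b w (x - w)).re ≤ (b x (x - w)).re := by
    have h := hb (x - w)
    rw [LinearMap.map_sub₂, Complex.sub_re] at h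
    linarith
  refine h₁.trans (le_of_eq ?_)
  rw [hx, inner_re_real_smul, map_sub, show f - j x = (f - j w) - (j x - j w) by abel,
    inner_sub_right, Complex.sub_re]
  have h₂ : (inner ℂ (j x - j w) (j x - j w)).re = ‖j x - j w‖ ^ 2 :=
    inner_self_eq_norm_sq (𝕜 := ℂ) _
  have h₃ : (inner ℂ (j x - j w) (f - j w)).re = (inner ℂ (f - j w) (j x - j w)).re :=
    inner_re_symm (𝕜 := ℂ) _ _
  rw [h₂, h₃]

/-- Apply the hypothesis to lifts `u`, `v` of the resolvents of `p`. With the projection inequality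
tested at `p`, the resolvent equations give `0 ≤ -l` times the squared distance from the resolvent
point to its projection, so that point lies in `C`. -/
theorem resolvent_invariant_of_proj (ha : a.IsAccretive) (hb : b.IsAccretive)
    (h : ∀ u v, ∃ w₁ w₂, IsProj C (j₁ w₁, j₂ w₂) (j₁ u, j₂ v) ∧
      0 ≤ (a w₁ (u - w₁)).re + (b w₂ (v - w₂)).re)
    {l : ℝ} (hl : 0 < l) {J : H →L[ℂ] H} {L : K →L[ℂ] K}
    (hJ : IsResolvent (a.AssocOp j₁) l J) (hL : IsResolvent (b.AssocOp j₂) l L)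
    {p : H × K} (hp : p ∈ C) : (J p.1, L p.2) ∈ C := by
  obtain ⟨u, hu, hau⟩ := hJ p.1
  obtain ⟨v, hv, hbv⟩ := hL p.2
  obtain ⟨w₁, w₂, ⟨hw, hproj⟩, hre⟩ := h u v
  rw [← hu] at hau
  rw [← hv] at hbv
  rw [← hu, ← hv]
  have h₁ := ha.re_le_of_resolvent (w := w₁) hau
  have h₂ := hb.re_le_of_resolvent (w := w₂) hbv
  have h₃ := hproj p hp
  simp only at h₃
  have h₄ : ‖j₁ u - j₁ w₁‖ ^ 2 + ‖j₂ v - j₂ w₂‖ ^ 2 ≤ 0 := by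
    by_contra hcon
    push Not at hcon
    nlinarith [mul_pos hl hcon]
  have h₅ : j₁ u - j₁ w₁ = 0 := norm_eq_zero.1 (pow_eq_zero_iff two_ne_zero |>.1
    (le_antisymm (by nlinarith [sq_nonneg ‖j₂ v - j₂ w₂‖]) (sq_nonneg _)))
  have h₆ : j₂ v - j₂ w₂ = 0 := norm_eq_zero.1 (pow_eq_zero_iff two_ne_zero |>.1
    (le_antisymm (by nlinarith [sq_nonneg ‖j₁ u - j₁ w₁‖]) (sq_nonneg _)))
  rwa [sub_eq_zero.1 h₅, sub_eq_zero.1 h₆]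

theorem le_of_quadratic_le {m p q c X Y : ℝ} (hm : 0 < m)
    (h : m * X ^ 2 + m * Y ^ 2 ≤ p * X + q * Y + c) :
    X ≤ 1 + (p ^ 2 + q ^ 2 + 2 * m * c) / m ^ 2 ∧ Y ≤ 1 + (p ^ 2 + q ^ 2 + 2 * m * c) / m ^ 2 := by
  have h₁ : m ^ 2 * (X ^ 2 + Y ^ 2) ≤ p ^ 2 + q ^ 2 + 2 * m * c := by
    nlinarith [sq_nonneg (m * X - p), sq_nonneg (m * Y - q), mul_le_mul_of_nonneg_left h hm.le]
  have h₂ : X ^ 2 + Y ^ 2 ≤ (p ^ 2 + q ^ 2 + 2 * m * c) / m ^ 2 := by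
    rw [le_div_iff₀ (by positivity)]; linarith
  constructor <;> nlinarith [sq_nonneg (X - 1), sq_nonneg (Y - 1), sq_nonneg X, sq_nonneg Y]

theorem Form.re_le_of_resolvent {j : V →L[ℂ] H} {l : ℝ} {f : H} {x : V}
    (hx : ∀ y, b x y = inner ℂ (j y) (l • (f - j x))) (hl : 0 < l) (v : V) :
    (b x x).re ≤ (b x v).re + l * (inner ℂ (j x - f) (j v - f)).re := by
  have h₁ : (b x x).re = (b x v).re + (b x (x - v)).re := by
    rw [map_sub, Complex.sub_re]; ring
  rw [h₁, hx (x - v), inner_re_real_smul, map_sub,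
    show j x - j v = (j x - f) - (j v - f) by abel, ← neg_sub (j x) f, inner_neg_right,
    inner_sub_left, Complex.neg_re, Complex.sub_re]
  have h₂ : (inner ℂ (j x - f) (j x - f)).re = ‖j x - f‖ ^ 2 := inner_self_eq_norm_sq (𝕜 := ℂ) _
  have h₃ : (inner ℂ (j v - f) (j x - f)).re = (inner ℂ (j x - f) (j v - f)).re :=
    inner_re_symm (𝕜 := ℂ) _ _
  rw [h₂, h₃]
  nlinarith [mul_nonneg hl.le (sq_nonneg ‖j x - f‖)]

variable [CompleteSpace U] [CompleteSpace V] [CompleteSpace H] [CompleteSpace K]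

omit [CompleteSpace K] [CompleteSpace U] in
theorem Form.limit_of_weak {α : Type*} {𝒰 : Filter α} [𝒰.NeBot] {x : α → V} {w : V}
    {j : V →L[ℂ] H} {f : H}
    (h : ∀ y, Tendsto (fun n => inner ℂ (x n) y) 𝒰 (𝓝 (inner ℂ w y)))
    (hf : Tendsto (fun n => j (x n)) 𝒰 (𝓝 f)) : j w = f := by
  refine ext_inner_right ℂ fun y => ?_
  have h₁ := h (ContinuousLinearMap.adjoint j y)
  simp only [ContinuousLinearMap.adjoint_inner_right] at h₁
  exact tendsto_nhds_unique h₁ (hf.inner tendsto_const_nhds)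

/-- The lifts `x l`, `y l` of the resolvents of the projection `p` stay bounded by ellipticity.
Since the resolvents converge strongly to `p`, a weak limit of the lifts lies over `p`, and the
inequality survives by weak lower semicontinuity. -/
theorem exists_proj_of_resolvent_invariant (ha : a.IsBounded) (hb : b.IsBounded)
    (ha_acc : a.IsAccretive) (hb_acc : b.IsAccretive)
    (hj₁ : DenseRange j₁) (hj₂ : DenseRange j₂)
    (ha_ell : a.IsElliptic j₁) (hb_ell : b.IsElliptic j₂)
    {J : ℝ → H →L[ℂ] H} {L : ℝ → K →L[ℂ] K}
    (hJ : ∀ᶠ l in atTop, IsResolvent (a.AssocOp j₁) l (J l))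
    (hL : ∀ᶠ l in atTop, IsResolvent (b.AssocOp j₂) l (L l))
    (h : ∀ᶠ l in atTop, ∀ p ∈ C, (J l p.1, L l p.2) ∈ C)
    (u : U) (v : V) {p : H × K} (hp : IsProj C p (j₁ u, j₂ v)) :
    ∃ w₁ w₂, (j₁ w₁, j₂ w₂) = p ∧ 0 ≤ (a w₁ (u - w₁)).re + (b w₂ (v - w₂)).re := by
  have hA := Form.isMAccretive_assocOp ha ha_acc hj₁ ha_ell
  have hB := Form.isMAccretive_assocOp hb hb_acc hj₂ hb_ell
  obtain ⟨x, hx⟩ := (hJ.mono fun l hl => hl p.1).choice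
  obtain ⟨y, hy⟩ := (hL.mono fun l hl => hl p.2).choice
  obtain ⟨M₁, hM₁, ha'⟩ := id ha
  obtain ⟨M₂, hM₂, hb'⟩ := id hb
  obtain ⟨ω₁, μ₁, hω₁, hμ₁, ha_ell⟩ := ha_ell.exists_nonneg
  obtain ⟨ω₂, μ₂, hω₂, hμ₂, hb_ell⟩ := hb_ell.exists_nonneg
  have hstar : ∀ᶠ l in atTop, (a (x l) (x l)).re + (b (y l) (y l)).re
      ≤ (a (x l) u).re + (b (y l) v).re := by
    filter_upwards [hx, hy, h, eventually_gt_atTop 0] with l ⟨hx₁, hx₂⟩ ⟨hy₁, hy₂⟩ hl hl₀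
    rw [← hx₁] at hx₂
    rw [← hy₁] at hy₂
    -- Invariance makes the resolvent point an admissible competitor in the projection inequality,
    -- which removes the terms carrying the factor `l`.
    have h₁ := hp.2 _ (hl p hp.1)
    rw [← hx₁, ← hy₁] at h₁
    simp only at h₁
    have h₂ := Form.re_le_of_resolvent hx₂ hl₀ u
    have h₃ := Form.re_le_of_resolvent hy₂ hl₀ v
    nlinarith [mul_le_mul_of_nonneg_left h₁ hl₀.le]
  have hbdd : ∃ R : ℝ, ∀ᶠ l in atTop, ‖x l‖ ≤ R ∧ ‖y l‖ ≤ R := by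
    refine ⟨1 + ((M₁ * ‖u‖) ^ 2 + (M₂ * ‖v‖) ^ 2 +
      2 * min μ₁ μ₂ * (ω₁ * ‖p.1‖ ^ 2 + ω₂ * ‖p.2‖ ^ 2)) / min μ₁ μ₂ ^ 2, ?_⟩
    · filter_upwards [hstar, hx, hy, hJ, hL, eventually_gt_atTop 0]
        with l hl ⟨hx₁, _⟩ ⟨hy₁, _⟩ hJl hLl hl₀
      refine le_of_quadratic_le (m := min μ₁ μ₂) (p := M₁ * ‖u‖) (q := M₂ * ‖v‖)
        (c := ω₁ * ‖p.1‖ ^ 2 + ω₂ * ‖p.2‖ ^ 2) (lt_min hμ₁ hμ₂) ?_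
      have h₁ := ha_ell (x l)
      have h₂ := hb_ell (y l)
      rw [hx₁] at h₁
      rw [hy₁] at h₂
      have h₃ : ω₁ * ‖J l p.1‖ ^ 2 ≤ ω₁ * ‖p.1‖ ^ 2 := by
        gcongr; exact hA.norm_resolvent_le hJl hl₀ _
      have h₄ : ω₂ * ‖L l p.2‖ ^ 2 ≤ ω₂ * ‖p.2‖ ^ 2 := by
        gcongr; exact hB.norm_resolvent_le hLl hl₀ _
      have h₅ : min μ₁ μ₂ * ‖x l‖ ^ 2 ≤ μ₁ * ‖x l‖ ^ 2 := by gcongr; exact min_le_left _ _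
      have h₆ : min μ₁ μ₂ * ‖y l‖ ^ 2 ≤ μ₂ * ‖y l‖ ^ 2 := by gcongr; exact min_le_right _ _
      have h₇ := (Complex.re_le_norm _).trans (ha' (x l) u)
      have h₈ := (Complex.re_le_norm _).trans (hb' (y l) v)
      nlinarith
  obtain ⟨R, hR⟩ := hbdd
  let 𝒰 : Ultrafilter ℝ := Ultrafilter.of atTop
  have h𝒰 : (𝒰 : Filter ℝ) ≤ atTop := Ultrafilter.of_le _
  obtain ⟨w₁, hw₁⟩ := exists_weak_limit 𝒰 (h𝒰 (hR.mono fun l hl => hl.1))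
  obtain ⟨w₂, hw₂⟩ := exists_weak_limit 𝒰 (h𝒰 (hR.mono fun l hl => hl.2))
  have e₁ : j₁ w₁ = p.1 := Form.limit_of_weak hw₁ <|
    ((hA.tendsto_resolvent hJ p.1).congr' (hx.mono fun l hl => hl.1.symm)).mono_left h𝒰
  have e₂ : j₂ w₂ = p.2 := Form.limit_of_weak hw₂ <|
    ((hB.tendsto_resolvent hL p.2).congr' (hy.mono fun l hl => hl.1.symm)).mono_left h𝒰
  refine ⟨w₁, w₂, Prod.ext e₁ e₂, ?_⟩
  have re := fun z : ℂ => Complex.continuous_re.tendsto z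
  have t₁ := ((re _).comp (Form.tendsto_of_weak ha hw₁ w₁).1).add
    ((re _).comp (Form.tendsto_of_weak ha hw₁ w₁).2)
  have t₂ := ((re _).comp (Form.tendsto_of_weak hb hw₂ w₂).1).add
    ((re _).comp (Form.tendsto_of_weak hb hw₂ w₂).2)
  have t₃ := ((re _).comp (Form.tendsto_of_weak ha hw₁ u).1).add
    ((re _).comp (Form.tendsto_of_weak hb hw₂ v).1)
  have t₄ := (t₁.sub_const (a w₁ w₁).re).add (t₂.sub_const (b w₂ w₂).re)
  -- Accretivity at `x l - w₁` bounds `Re a(x, x)` below by `Re (a(x, w₁) + a(w₁, x) - a(w₁, w₁))`,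
  -- which is weakly continuous in `x`; likewise for `b`.
  have hle := le_of_tendsto_of_tendsto t₄ t₃ (by
    filter_upwards [h𝒰 hstar] with l hl
    have h₁ := ha_acc (x l - w₁)
    have h₂ := hb_acc (y l - w₂)
    simp only [map_sub, LinearMap.sub_apply, Complex.sub_re] at h₁ h₂
    simp only [Function.comp_apply]
    linarith)
  rw [map_sub, map_sub, Complex.sub_re, Complex.sub_re]
  linarith

end Projection

/-! ### Lattice operations on `L₂` and the domination cone. -/

section LatticeL2

variable {X : Type*} [MeasurableSpace X] {μ : Measure X}

theorem coeFn_absL2 (f : Lp ℂ 2 μ) : absL2 f =ᵐ[μ] fun x => ((‖f x‖ : ℝ) : ℂ) :=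
  MemLp.coeFn_toLp _

theorem coeFn_reL2 (f : Lp ℂ 2 μ) : reL2 f =ᵐ[μ] fun x => (((f x).re : ℝ) : ℂ) :=
  MemLp.coeFn_toLp _

theorem coeFn_supL2 (f g : Lp ℂ 2 μ) :
    supL2 f g =ᵐ[μ] fun x => ((max (f x).re (g x).re : ℝ) : ℂ) :=
  MemLp.coeFn_toLp _

theorem coeFn_absMulSignL2 (f g : Lp ℂ 2 μ) :
    absMulSignL2 f g =ᵐ[μ] fun x => ((‖f x‖ : ℝ) : ℂ) * csign (g x) :=
  MemLp.coeFn_toLp _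

theorem isRealL2_absL2 (f : Lp ℂ 2 μ) : IsRealL2 (absL2 f) := by
  filter_upwards [coeFn_absL2 f] with x hx
  rw [hx, Complex.ofReal_im]

theorem isRealL2_reL2 (f : Lp ℂ 2 μ) : IsRealL2 (reL2 f) := by
  filter_upwards [coeFn_reL2 f] with x hx
  rw [hx, Complex.ofReal_im]

theorem isRealL2_supL2 (f g : Lp ℂ 2 μ) : IsRealL2 (supL2 f g) := by
  filter_upwards [coeFn_supL2 f g] with x hx
  rw [hx, Complex.ofReal_im]

theorem isRealL2_zero : IsRealL2 (0 : Lp ℂ 2 μ) := by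
  filter_upwards [Lp.coeFn_zero ℂ 2 μ] with x hx
  rw [hx]; rfl

theorem IsRealL2.neg {f : Lp ℂ 2 μ} (hf : IsRealL2 f) : IsRealL2 (-f) := by
  filter_upwards [hf, Lp.coeFn_neg f] with x h₁ h₂
  rw [h₂, Pi.neg_apply, Complex.neg_im, h₁, neg_zero]

theorem IsRealL2.add {f g : Lp ℂ 2 μ} (hf : IsRealL2 f) (hg : IsRealL2 g) :
    IsRealL2 (f + g) := by
  filter_upwards [hf, hg, Lp.coeFn_add f g] with x h₁ h₂ h₃
  rw [h₃, Pi.add_apply, Complex.add_im, h₁, h₂, add_zero]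

theorem IsRealL2.sub {f g : Lp ℂ 2 μ} (hf : IsRealL2 f) (hg : IsRealL2 g) :
    IsRealL2 (f - g) := by
  rw [sub_eq_add_neg]; exact hf.add hg.neg

theorem norm_mul_csign (z : ℂ) : (‖z‖ : ℂ) * csign z = z := by
  unfold csign
  split_ifs with h
  · simp [h]
  · field_simp [show (‖z‖ : ℂ) ≠ 0 by simpa using h]

/-- The closed convex cone of the pairs `(f, g)` with `|f| ≤ g`. -/
def dominationCone (μ : Measure X) : Set (Lp ℂ 2 μ × Lp ℂ 2 μ) := {p | AbsLe p.1 p.2}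

theorem convex_dominationCone : Convex ℝ (dominationCone μ) := by
  intro p hp q hq s t hs ht _
  change AbsLe (s • p.1 + t • q.1) (s • p.2 + t • q.2)
  filter_upwards [hp, hq, Lp.coeFn_add (s • p.1) (t • q.1), Lp.coeFn_add (s • p.2) (t • q.2),
    Lp.coeFn_smul s p.1, Lp.coeFn_smul s p.2, Lp.coeFn_smul t q.1, Lp.coeFn_smul t q.2]
    with x h₁ h₂ e₁ e₂ e₃ e₄ e₅ e₆
  rw [e₁, e₂, Pi.add_apply, Pi.add_apply, e₃, e₄, e₅, e₆]
  simp only [Pi.smul_apply]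
  refine ⟨by simp [h₁.1, h₂.1], (norm_add_le _ _).trans ?_⟩
  rw [norm_smul, norm_smul, Real.norm_of_nonneg hs, Real.norm_of_nonneg ht, Complex.add_re,
    Complex.smul_re, Complex.smul_re, smul_eq_mul, smul_eq_mul]
  exact add_le_add (mul_le_mul_of_nonneg_left h₁.2 hs) (mul_le_mul_of_nonneg_left h₂.2 ht)

theorem exists_subseq_tendsto_ae {F : ℕ → Lp ℂ 2 μ} {f : Lp ℂ 2 μ}
    (h : Tendsto F atTop (𝓝 f)) :
    ∃ ns : ℕ → ℕ, StrictMono ns ∧ ∀ᵐ x ∂μ, Tendsto (fun n => F (ns n) x) atTop (𝓝 (f x)) :=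
  (tendstoInMeasure_of_tendsto_Lp h).exists_seq_tendsto_ae

theorem isClosed_dominationCone : IsClosed (dominationCone μ) := by
  refine IsSeqClosed.isClosed fun F p hF hlim => ?_
  obtain ⟨ns, hns, h₁⟩ := exists_subseq_tendsto_ae ((continuous_fst.tendsto p).comp hlim)
  obtain ⟨ms, hms, h₂⟩ := exists_subseq_tendsto_ae
    (((continuous_snd.tendsto p).comp hlim).comp hns.tendsto_atTop)
  filter_upwards [h₁, h₂, ae_all_iff.2 hF] with x hx₁ hx₂ hx
  have hx₁ := hx₁.comp hms.tendsto_atTop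
  constructor
  · exact tendsto_nhds_unique ((Complex.continuous_im.tendsto _).comp hx₂)
      (tendsto_const_nhds.congr fun n => ((hx _).1).symm)
  · exact le_of_tendsto_of_tendsto' hx₁.norm ((Complex.continuous_re.tendsto _).comp hx₂)
      fun n => (hx _).2

end LatticeL2

/-! ### The explicit projection onto the domination cone. -/

section ProjectionL2

variable {X : Type*} [MeasurableSpace X] {μ : Measure X}

/-- The modulus `(|f| + |f| ∧ Re g)⁺ / 2` of the first component of the projection of `(f, g)`
onto `dominationCone μ`. -/
def projModulus (f g : Lp ℂ 2 μ) : Lp ℂ 2 μ :=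
  (2⁻¹ : ℂ) • supL2 (absL2 f - supL2 (-absL2 f) (-reL2 g)) 0

/-- The first component of the projection of `(f, g)` onto `dominationCone μ`. -/
def projFst (f g : Lp ℂ 2 μ) : Lp ℂ 2 μ := absMulSignL2 (projModulus f g) f

/-- The second component of the projection of `(f, g)` onto `dominationCone μ`. -/
def projSnd (f g : Lp ℂ 2 μ) : Lp ℂ 2 μ :=
  (2⁻¹ : ℂ) • supL2 (supL2 (absL2 f) (reL2 g) + reL2 g) 0

theorem coeFn_projModulus (f g : Lp ℂ 2 μ) : projModulus f g =ᵐ[μ]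
    fun x => ((2⁻¹ * max (‖f x‖ - max (-‖f x‖) (-(g x).re)) 0 : ℝ) : ℂ) := by
  filter_upwards [Lp.coeFn_smul (2⁻¹ : ℂ) (supL2 (absL2 f - supL2 (-absL2 f) (-reL2 g)) 0),
    coeFn_supL2 (absL2 f - supL2 (-absL2 f) (-reL2 g)) 0, Lp.coeFn_zero ℂ 2 μ,
    Lp.coeFn_sub (absL2 f) (supL2 (-absL2 f) (-reL2 g)), coeFn_supL2 (-absL2 f) (-reL2 g),
    Lp.coeFn_neg (absL2 f), Lp.coeFn_neg (reL2 g), coeFn_absL2 f, coeFn_reL2 g]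
    with x h₁ h₂ h₃ h₄ h₅ h₆ h₇ h₈ h₉
  rw [projModulus, h₁, Pi.smul_apply, h₂, h₃, h₄, Pi.sub_apply, h₅, h₆, h₇, Pi.neg_apply,
    Pi.neg_apply, h₈, h₉]
  simp

theorem coeFn_projSnd (f g : Lp ℂ 2 μ) : projSnd f g =ᵐ[μ]
    fun x => ((2⁻¹ * max (max ‖f x‖ (g x).re + (g x).re) 0 : ℝ) : ℂ) := by
  filter_upwards [Lp.coeFn_smul (2⁻¹ : ℂ) (supL2 (supL2 (absL2 f) (reL2 g) + reL2 g) 0),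
    coeFn_supL2 (supL2 (absL2 f) (reL2 g) + reL2 g) 0, Lp.coeFn_zero ℂ 2 μ,
    Lp.coeFn_add (supL2 (absL2 f) (reL2 g)) (reL2 g), coeFn_supL2 (absL2 f) (reL2 g),
    coeFn_absL2 f, coeFn_reL2 g]
    with x h₁ h₂ h₃ h₄ h₅ h₆ h₇
  rw [projSnd, h₁, Pi.smul_apply, h₂, h₃, h₄, Pi.add_apply, h₅, h₆, h₇]
  simp

theorem projModulus_real_le {r σ : ℝ} (hr : 0 ≤ r) :
    0 ≤ 2⁻¹ * max (r - max (-r) (-σ)) 0 ∧ 2⁻¹ * max (r - max (-r) (-σ)) 0 ≤ r ∧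
      2⁻¹ * max (r - max (-r) (-σ)) 0 ≤ 2⁻¹ * max (max r σ + σ) 0 := by
  grind

/-- Three regions: for `r ≤ σ` the point is in the cone and stays fixed; for `|σ| ≤ r` it goes to
the midpoint on the boundary ray; for `σ ≤ -r` it lies in the polar cone and goes to `0`. -/
theorem proj_real_le {r σ τ s h k : ℝ} (hr : 0 ≤ r) (hτ : |τ| ≤ s)
    (hh : h = 2⁻¹ * max (r - max (-r) (-σ)) 0) (hk : k = 2⁻¹ * max (max r σ + σ) 0) :
    (r - h) * (τ - h) + (s - k) * (σ - k) ≤ 0 := by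
  have hτ' := abs_le.1 hτ
  rcases le_total r σ with h₁ | h₁
  · have e₁ : h = r := by grind
    have e₂ : k = σ := by grind
    rw [e₁, e₂]; simp
  rcases le_total (-r) σ with h₂ | h₂
  · have e₁ : h = (r + σ) / 2 := by grind
    have e₂ : k = (r + σ) / 2 := by grind
    rw [e₁, e₂]; nlinarith
  · have e₁ : h = 0 := by grind
    have e₂ : k = 0 := by grind
    rw [e₁, e₂]; nlinarith

theorem proj_complex_le {z w z' w' : ℂ} {h k : ℝ} (him : w'.im = 0) (hle : ‖z'‖ ≤ w'.re)
    (hh : h = 2⁻¹ * max (‖z‖ - max (-‖z‖) (-w.re)) 0)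
    (hk : k = 2⁻¹ * max (max ‖z‖ w.re + w.re) 0) :
    (inner ℂ (z' - (‖(h : ℂ)‖ : ℂ) * csign z) (z - (‖(h : ℂ)‖ : ℂ) * csign z)).re
      + (inner ℂ (w' - k) (w - k)).re ≤ 0 := by
  obtain ⟨h₀, h₁, -⟩ := projModulus_real_le (σ := w.re) (norm_nonneg z)
  rw [← hh] at h₀ h₁
  rw [Complex.norm_real, Real.norm_of_nonneg h₀]
  have e₁ : (inner ℂ (w' - k) (w - k)).re = (w'.re - k) * (w.re - k) := by
    simp [him]; ring
  have e₂ : z - (h : ℂ) * csign z = ((‖z‖ - h : ℝ) : ℂ) * csign z := by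
    nth_rewrite 1 [← norm_mul_csign z]
    push_cast; ring
  -- For `z = 0` the sign vanishes, but then `h = 0 = ‖z‖` and both sides are zero.
  have e₃ : (‖z‖ - h) * (csign z * (starRingEnd ℂ) (csign z)).re = ‖z‖ - h := by
    rw [Complex.mul_conj, Complex.ofReal_re, Complex.normSq_eq_norm_sq]
    unfold csign
    split_ifs with hz
    · rw [hz, norm_zero] at h₁ ⊢
      rw [le_antisymm h₁ h₀]; simp
    · simp [hz]
  have e₄ : (inner ℂ (z' - (h : ℂ) * csign z) (z - (h : ℂ) * csign z)).re
      = (‖z‖ - h) * ((inner ℂ z' (csign z)).re - h) := by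
    rw [e₂, RCLike.inner_apply, RCLike.inner_apply, map_sub, map_mul, Complex.conj_ofReal]
    have e₅ : ((‖z‖ - h : ℝ) : ℂ) * csign z * ((starRingEnd ℂ) z' - h * (starRingEnd ℂ) (csign z))
        = ((‖z‖ - h : ℝ) : ℂ) * (csign z * (starRingEnd ℂ) z')
          - (h : ℂ) * (((‖z‖ - h : ℝ) : ℂ) * (csign z * (starRingEnd ℂ) (csign z))) := by ring
    rw [e₅, Complex.sub_re, Complex.re_ofReal_mul, Complex.re_ofReal_mul, Complex.re_ofReal_mul, e₃]
    ring
  rw [e₁, e₄]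
  refine proj_real_le (norm_nonneg z) ((Complex.abs_re_le_norm _).trans ?_) hh hk
  calc _ ≤ ‖z'‖ * ‖csign z‖ := norm_inner_le_norm z' (csign z)
    _ ≤ ‖z'‖ * 1 := by gcongr; exact norm_csign_le z
    _ ≤ w'.re := by rwa [mul_one]

theorem inner_re_eq_integral (f g : Lp ℂ 2 μ) :
    (inner ℂ f g).re = ∫ x, (inner ℂ (f x) (g x)).re ∂μ := by
  rw [L2.inner_def]
  exact (integral_re (L2.integrable_inner (𝕜 := ℂ) f g)).symm

theorem isProj_dominationCone (f g : Lp ℂ 2 μ) :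
    IsProj (dominationCone μ) (projFst f g, projSnd f g) (f, g) := by
  constructor
  · filter_upwards [coeFn_projSnd f g, coeFn_absMulSignL2 (projModulus f g) f,
      coeFn_projModulus f g] with x h₁ h₂ h₃
    rw [h₁, projFst, h₂, h₃, Complex.ofReal_im, Complex.ofReal_re]
    obtain ⟨h₄, -, h₅⟩ := projModulus_real_le (σ := (g x).re) (norm_nonneg (f x))
    refine ⟨rfl, le_trans ?_ h₅⟩
    rw [norm_mul, Complex.norm_real, Complex.norm_real, Real.norm_of_nonneg h₄,
      Real.norm_of_nonneg h₄]
    exact mul_le_of_le_one_right h₄ (norm_csign_le _)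
  · rintro ⟨f', g'⟩ hr
    simp only
    have hint := fun u v : Lp ℂ 2 μ => (L2.integrable_inner (𝕜 := ℂ) u v).re
    rw [inner_re_eq_integral, inner_re_eq_integral]
    refine (integral_add (hint _ _) (hint _ _)).symm.trans_le (integral_nonpos_of_ae ?_)
    filter_upwards [hr, coeFn_projSnd f g, coeFn_absMulSignL2 (projModulus f g) f,
      coeFn_projModulus f g, Lp.coeFn_sub f (projFst f g), Lp.coeFn_sub f' (projFst f g),
      Lp.coeFn_sub g (projSnd f g), Lp.coeFn_sub g' (projSnd f g)]
      with x h₀ h₁ h₂ h₃ h₄ h₅ h₆ h₇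
    rw [h₄, h₅, h₆, h₇]
    simp only [Pi.sub_apply, Pi.zero_apply]
    rw [h₁, projFst, h₂, h₃]
    exact proj_complex_le h₀.1 h₀.2 rfl rfl

theorem absLeAbs_projModulus (f g : Lp ℂ 2 μ) : AbsLeAbs (projModulus f g) f := by
  filter_upwards [coeFn_projModulus f g] with x hx
  obtain ⟨h₄, h₅, -⟩ := projModulus_real_le (σ := (g x).re) (norm_nonneg (f x))
  rwa [hx, Complex.norm_real, Real.norm_of_nonneg h₄]

/-- This and the next three identities recover modulus, real part and supremum from `projSnd`, so
that a space stable under the projection is stable under these operations. -/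
theorem two_smul_projSnd_zero (f : Lp ℂ 2 μ) : (2 : ℂ) • projSnd f 0 = absL2 f := by
  refine Lp.ext ?_
  filter_upwards [Lp.coeFn_smul (2 : ℂ) (projSnd f 0), coeFn_projSnd f 0, coeFn_absL2 f,
    Lp.coeFn_zero ℂ 2 μ] with x h₁ h₂ h₃ h₄
  rw [h₁, Pi.smul_apply, h₂, h₃, h₄]
  simp

theorem projSnd_zero_left (g : Lp ℂ 2 μ) : projSnd 0 g = supL2 (reL2 g) 0 := by
  refine Lp.ext ?_
  filter_upwards [coeFn_projSnd 0 g, coeFn_supL2 (reL2 g) 0, coeFn_reL2 g,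
    Lp.coeFn_zero ℂ 2 μ] with x h₁ h₂ h₃ h₄
  rw [h₁, h₂, h₃, h₄]
  simp only [Pi.zero_apply, norm_zero, Complex.ofReal_re, Complex.zero_re]
  congr 1
  grind

theorem supL2_reL2_sub (g : Lp ℂ 2 μ) :
    supL2 (reL2 g) 0 - supL2 (reL2 (-g)) 0 = reL2 g := by
  refine Lp.ext ?_
  filter_upwards [Lp.coeFn_sub (supL2 (reL2 g) 0) (supL2 (reL2 (-g)) 0), coeFn_supL2 (reL2 g) 0,
    coeFn_supL2 (reL2 (-g)) 0, coeFn_reL2 g, coeFn_reL2 (-g), Lp.coeFn_neg g,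
    Lp.coeFn_zero ℂ 2 μ] with x h₁ h₂ h₃ h₄ h₅ h₆ h₇
  rw [h₁, Pi.sub_apply, h₂, h₃, h₄, h₅, h₆, h₇]
  simp only [Pi.zero_apply, Pi.neg_apply, Complex.ofReal_re, Complex.zero_re, Complex.neg_re]
  rw [← Complex.ofReal_sub]
  congr 1
  grind

theorem supL2_eq_add (f : Lp ℂ 2 μ) {g : Lp ℂ 2 μ} (hg : IsRealL2 g) :
    supL2 f g = g + supL2 (reL2 (f - g)) 0 := by
  refine Lp.ext ?_
  filter_upwards [coeFn_supL2 f g, Lp.coeFn_add g (supL2 (reL2 (f - g)) 0),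
    coeFn_supL2 (reL2 (f - g)) 0, coeFn_reL2 (f - g), Lp.coeFn_sub f g,
    Lp.coeFn_zero ℂ 2 μ, hg] with x h₁ h₂ h₃ h₄ h₅ h₆ h₇
  rw [h₁, h₂, Pi.add_apply, h₃, h₄, h₅, h₆]
  simp only [Pi.zero_apply, Pi.sub_apply, Complex.ofReal_re, Complex.zero_re, Complex.sub_re]
  refine Complex.ext ?_ ?_
  · simp only [Complex.add_re, Complex.ofReal_re]; grind
  · simp [h₇]

/-- Domination makes `T` positive, so for `|f| ≤ g` it follows that `|S f| ≤ T |f| ≤ T g`. -/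
theorem IsDominatedBy.invariant {S T : ℝ≥0 → Lp ℂ 2 μ →L[ℂ] Lp ℂ 2 μ} (h : IsDominatedBy S T)
    (t : ℝ≥0) {p : Lp ℂ 2 μ × Lp ℂ 2 μ} (hp : p ∈ dominationCone μ) :
    (S t p.1, T t p.2) ∈ dominationCone μ := by
  have h₁ : absL2 (p.2 - absL2 p.1) = p.2 - absL2 p.1 := by
    refine Lp.ext ?_
    filter_upwards [hp, coeFn_absL2 (p.2 - absL2 p.1), Lp.coeFn_sub p.2 (absL2 p.1),
      coeFn_absL2 p.1] with x h₀ h₁ h₂ h₃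
    rw [h₁, h₂, Pi.sub_apply, h₃]
    have h₄ : p.2 x = ((p.2 x).re : ℂ) := Complex.ext rfl (by simp [h₀.1])
    rw [h₄, ← Complex.ofReal_sub, Complex.norm_real, Real.norm_of_nonneg (sub_nonneg.2 h₀.2)]
  have h₂ := h t (p.2 - absL2 p.1)
  rw [h₁, map_sub (T t)] at h₂
  filter_upwards [h t p.1, h₂, Lp.coeFn_sub (T t p.2) (T t (absL2 p.1))] with x h₃ h₄ h₅
  rw [h₅, Pi.sub_apply, Complex.sub_im, Complex.sub_re] at h₄
  exact ⟨by linarith [h₃.1, h₄.1], h₃.2.trans (by linarith [(norm_nonneg _).trans h₄.2])⟩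

theorem mem_dominationCone_absL2 (f : Lp ℂ 2 μ) : (f, absL2 f) ∈ dominationCone μ := by
  filter_upwards [coeFn_absL2 f] with x hx
  rw [hx]
  exact ⟨Complex.ofReal_im _, le_rfl⟩

end ProjectionL2

/-! ### Transport of the projection from `ι₁`, `ι₂` to `j₁`, `j₂`. -/

section Transference

variable {X' X : Type*} [MeasurableSpace X'] [MeasurableSpace X] {μ' : Measure X'} {μ : Measure X}
  {U V : Type*} [NormedAddCommGroup U] [InnerProductSpace ℂ U]
  [NormedAddCommGroup V] [InnerProductSpace ℂ V]
  {ι₁ : U →L[ℂ] Lp ℂ 2 μ'} {ι₂ : V →L[ℂ] Lp ℂ 2 μ'}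
  {j₁ : U →L[ℂ] Lp ℂ 2 μ} {j₂ : V →L[ℂ] Lp ℂ 2 μ}

/-- If the projection onto the domination cone acts on `U × V`, then it commutes with passing from
the embedding `(ι₁, ι₂)` to `(j₁, j₂)`. -/
theorem LatticeCompatible.map_proj (hc : LatticeCompatible ι₁ ι₂ j₁ j₂)
    (hι₂ : Function.Injective ι₂)
    (h : ∀ u v, ∃ w₂, ι₂ w₂ = projSnd (ι₁ u) (ι₂ v)) {u w₁ : U} {v w₂ : V}
    (h₁ : ι₁ w₁ = projFst (ι₁ u) (ι₂ v)) (h₂ : ι₂ w₂ = projSnd (ι₁ u) (ι₂ v)) :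
    j₁ w₁ = projFst (j₁ u) (j₂ v) ∧ j₂ w₂ = projSnd (j₁ u) (j₂ v) := by
  have habs : ∃ m, ι₂ m = absL2 (ι₁ u) := by
    obtain ⟨w, hw⟩ := h u 0
    exact ⟨(2 : ℂ) • w, by rw [map_smul, hw, map_zero, two_smul_projSnd_zero]⟩
  have hpos : ∀ v, ∃ w, ι₂ w = supL2 (reL2 (ι₂ v)) 0 := fun v => by
    obtain ⟨w, hw⟩ := h 0 v
    exact ⟨w, by rw [hw, map_zero, projSnd_zero_left]⟩
  have hre : ∃ r, ι₂ r = reL2 (ι₂ v) := by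
    obtain ⟨w, hw⟩ := hpos v
    obtain ⟨w', hw'⟩ := hpos (-v)
    exact ⟨w - w', by rw [map_sub, hw, hw', map_neg, supL2_reL2_sub]⟩
  have hsup : ∀ v₁ v₂, IsRealL2 (ι₂ v₁) → IsRealL2 (ι₂ v₂) →
      ∃ w, ι₂ w = supL2 (ι₂ v₁) (ι₂ v₂) ∧ j₂ w = supL2 (j₂ v₁) (j₂ v₂) := by
    intro v₁ v₂ hv₁ hv₂
    obtain ⟨w, hw⟩ := hpos (v₁ - v₂)
    have hw' : ι₂ (v₂ + w) = supL2 (ι₂ v₁) (ι₂ v₂) := by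
      rw [map_add, hw, map_sub, supL2_eq_add _ hv₂]
    exact ⟨v₂ + w, hw', hc.map_sup _ _ _ hv₁ hv₂ hw'⟩
  obtain ⟨m, hm⟩ := habs
  obtain ⟨r, hr⟩ := hre
  have hjm := hc.map_abs u m hm
  have hjr := hc.map_re v r hr
  have hmr : IsRealL2 (ι₂ m) := by rw [hm]; exact isRealL2_absL2 _
  have hrr : IsRealL2 (ι₂ r) := by rw [hr]; exact isRealL2_reL2 _
  have h0r : IsRealL2 (ι₂ 0) := by rw [map_zero]; exact isRealL2_zero
  constructor
  -- Only suprema are transported, so `|u| ∧ Re v` enters as `-(-|u| ∨ -Re v)`.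
  · obtain ⟨k, hk, hjk⟩ := hsup (-m) (-r) (by rw [map_neg]; exact hmr.neg)
      (by rw [map_neg]; exact hrr.neg)
    have hkr : IsRealL2 (ι₂ k) := by rw [hk]; exact isRealL2_supL2 _ _
    obtain ⟨n, hn, hjn⟩ := hsup (m - k) 0 (by rw [map_sub]; exact hmr.sub hkr) h0r
    have hι : ι₂ ((2⁻¹ : ℂ) • n) = projModulus (ι₁ u) (ι₂ v) := by
      rw [map_smul, hn, map_zero, map_sub, hk, map_neg, map_neg, hm, hr, projModulus]
    have hj : j₂ ((2⁻¹ : ℂ) • n) = projModulus (j₁ u) (j₂ v) := by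
      rw [map_smul, hjn, map_zero, map_sub, hjk, map_neg, map_neg, hjm, hjr, projModulus]
    rw [hc.map_abs_mul_sign u ((2⁻¹ : ℂ) • n) w₁ (by rw [hι]; exact absLeAbs_projModulus _ _)
      (by rw [hι, h₁, projFst]), hj, projFst]
  · obtain ⟨k, hk, hjk⟩ := hsup m r hmr hrr
    have hkr : IsRealL2 (ι₂ k) := by rw [hk]; exact isRealL2_supL2 _ _
    obtain ⟨n, hn, hjn⟩ := hsup (k + r) 0 (by rw [map_add]; exact hkr.add hrr) h0r
    have hι : ι₂ ((2⁻¹ : ℂ) • n) = projSnd (ι₁ u) (ι₂ v) := by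
      rw [map_smul, hn, map_zero, map_add, hk, hm, hr, projSnd]
    rw [hι₂ (h₂.trans hι.symm), map_smul, hjn, map_zero, map_add, hjk, hjm, hjr, projSnd]

end Transference

end FormDomination

end

theorem theorem5p1
    {X' X : Type*} [MeasurableSpace X'] [MeasurableSpace X]
    (μ' : Measure X') (μ : Measure X) [SigmaFinite μ'] [SigmaFinite μ]
    {U V : Type*}
    [NormedAddCommGroup U] [InnerProductSpace ℂ U] [CompleteSpace U]
    [NormedAddCommGroup V] [InnerProductSpace ℂ V] [CompleteSpace V]
    -- the continuous dense embeddings of `U` and `V` into `L₂(X')`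
    (ι₁ : U →L[ℂ] Lp ℂ 2 μ') (hι₁ : Function.Injective ι₁) (hι₁d : DenseRange ι₁)
    (ι₂ : V →L[ℂ] Lp ℂ 2 μ') (hι₂ : Function.Injective ι₂) (hι₂d : DenseRange ι₂)
    -- the maps `j₁` and `j₂` into `L₂(X)`
    (j₁ : U →L[ℂ] Lp ℂ 2 μ) (hj₁d : DenseRange j₁)
    (j₂ : V →L[ℂ] Lp ℂ 2 μ) (hj₂d : DenseRange j₂)
    -- the forms: continuous, accretive, quasi-coercive and `j`-elliptic
    (a : FormDomination.Form U) (ha : a.IsBounded) (ha_acc : a.IsAccretive)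
    (ha_qc : a.IsElliptic ι₁) (ha_ell : a.IsElliptic j₁)
    (b : FormDomination.Form V) (hb : b.IsBounded) (hb_acc : b.IsAccretive)
    (hb_qc : b.IsElliptic ι₂) (hb_ell : b.IsElliptic j₂)
    -- domination of the semigroups on `L₂(X')`
    (hdom : ∀ S' T' : ℝ≥0 → Lp ℂ 2 μ' →L[ℂ] Lp ℂ 2 μ',
      FormDomination.IsSemigroupGeneratedByNeg S' (a.AssocOp ι₁) →
      FormDomination.IsSemigroupGeneratedByNeg T' (b.AssocOp ι₂) →
      FormDomination.IsDominatedBy S' T')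
    -- lattice compatibility of `j₁` and `j₂`
    (hcompat : FormDomination.LatticeCompatible ι₁ ι₂ j₁ j₂) :
    (∃! S : ℝ≥0 → Lp ℂ 2 μ →L[ℂ] Lp ℂ 2 μ,
      FormDomination.IsSemigroupGeneratedByNeg S (a.AssocOp j₁)) ∧
    (∃! T : ℝ≥0 → Lp ℂ 2 μ →L[ℂ] Lp ℂ 2 μ,
      FormDomination.IsSemigroupGeneratedByNeg T (b.AssocOp j₂)) ∧
    ∀ S T : ℝ≥0 → Lp ℂ 2 μ →L[ℂ] Lp ℂ 2 μ,
      FormDomination.IsSemigroupGeneratedByNeg S (a.AssocOp j₁) →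
      FormDomination.IsSemigroupGeneratedByNeg T (b.AssocOp j₂) →
      FormDomination.IsDominatedBy S T := by 
  have hA' := FormDomination.Form.isMAccretive_assocOp ha ha_acc hι₁d ha_qc
  have hB' := FormDomination.Form.isMAccretive_assocOp hb hb_acc hι₂d hb_qc
  have hA := FormDomination.Form.isMAccretive_assocOp ha ha_acc hj₁d ha_ell
  have hB := FormDomination.Form.isMAccretive_assocOp hb hb_acc hj₂d hb_ell
  refine ⟨hA.existsUnique_semigroup, hB.existsUnique_semigroup, fun S T hS hT t f => ?_⟩
  obtain ⟨S', hS'⟩ := hA'.exists_semigroup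
  obtain ⟨T', hT'⟩ := hB'.exists_semigroup
  obtain ⟨J', hJ'⟩ := hA'.exists_isResolvent
  obtain ⟨L', hL'⟩ := hB'.exists_isResolvent
  have hinv' : ∀ᶠ l in atTop, ∀ p ∈ FormDomination.dominationCone μ',
      (J' l p.1, L' l p.2) ∈ FormDomination.dominationCone μ' := by
    filter_upwards [hJ', hL', eventually_gt_atTop 0] with l hJl hLl hl p hp
    exact FormDomination.resolvent_invariant hA' hB' hS' hT' hl hJl hLl
      FormDomination.isClosed_dominationCone FormDomination.convex_dominationCone
      (fun t _ hp => (hdom S' T' hS' hT').invariant t hp) hp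
  have hproj' := fun u v => FormDomination.exists_proj_of_resolvent_invariant ha hb ha_acc hb_acc
    hι₁d hι₂d ha_qc hb_qc hJ' hL' hinv' u v (FormDomination.isProj_dominationCone (ι₁ u) (ι₂ v))
  -- The transfer: the same `w₁`, `w₂` serve for `j₁`, `j₂`, with `hre` unchanged.
  have hproj : ∀ u v, ∃ w₁ w₂, FormDomination.IsProj (FormDomination.dominationCone μ)
      (j₁ w₁, j₂ w₂) (j₁ u, j₂ v) ∧ 0 ≤ (a w₁ (u - w₁)).re + (b w₂ (v - w₂)).re := by
    intro u v
    obtain ⟨w₁, w₂, hw, hre⟩ := hproj' u v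
    obtain ⟨e₁, e₂⟩ := hcompat.map_proj hι₂
      (fun u v => let ⟨_, w, h, _⟩ := hproj' u v; ⟨w, (Prod.ext_iff.1 h).2⟩)
      (Prod.ext_iff.1 hw).1 (Prod.ext_iff.1 hw).2
    refine ⟨w₁, w₂, ?_, hre⟩
    rw [e₁, e₂]
    exact FormDomination.isProj_dominationCone (j₁ u) (j₂ v)
  obtain ⟨J, hJ⟩ := hA.exists_isResolvent
  obtain ⟨L, hL⟩ := hB.exists_isResolvent
  exact FormDomination.semigroup_invariant hA hB hS hT hJ hL
    FormDomination.isClosed_dominationCone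
    (fun l hl hJl hLl p hp => FormDomination.resolvent_invariant_of_proj ha_acc hb_acc hproj hl
      hJl hLl hp) t (FormDomination.mem_dominationCone_absL2 f)
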